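/- Let $n\ge 3$ be an odd integer and let $k$ be any field. Let $D_n=\langle\sigma,\tau:\sigma^n=\tau^2=1,\ \tau\sigma\tau^{-1}=\sigma^{-1}\rangle$ be the dihedral group of order $2n$, let $F=\langle s_1,s_2\rangle$ be the free group of rank two, and let $R$ be the kernel of the surjection $\varepsilon:F\to D_n$ with $\varepsilon(s_1)=\sigma$, $\varepsilon(s_2)=\tau$. Conjugation in $F$ makes $R^{ab}=R/[R,R]$ a $\mathbb{Z}[D_n]$-lattice. For a field extension $k'/k$ on which $D_n$ acts through a homomorphism $D_n\to\mathrm{Gal}(k'/k)$, and a $\mathbb{Z}[D_n]$-lattice $M=\bigoplus_i\mathbb{Z}e_i$, let $D_n$ act on the rational function field $k'(M)=k'(x_i)_i$ by its given action on $k'$ and by $g\cdot x_j=\prod_i x_i^{a_{ij}}$ if $g\cdot e_j=\sum_i a_{ij}e_i$. Let $k'(M)^{D_n}$ be the fixed field. Write $k(M)^{D_n}$ for the case $k'=k$ with trivial action on $k$. Let $k(D_n)=k(x_g:g\in D_n)^{D_n}$, where $D_n$ acts by $k$-automorphisms with $h\cdot x_g=x_{hg}$. A field extension $L/k$ is called $k$-rational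 if $L$ is $k$-isomorphic to $k(X_1,\dots,X_m)$ for some $m$. Then: 1. If $k'/k$ is a finite Galois extension and $D_n$ acts on $k'$ through a surjection $D_n\to\mathrm{Gal}(k'/k)$, then there is a $k$-isomorphism $k'(R^{ab})^{D_n}\cong k'(\mathbb{Z}[D_n])^{D_n}(t)$ with $t$ transcendental over $k'(\mathbb{Z}[D_n])^{D_n}$. 2. There is a $k$-isomorphism $k(R^{ab})^{D_n}\cong k(D_n)(t)$ with $t$ transcendental over $k(D_n)$. 3. If Noether's problem for $D_n$ over $k$ has a positive answer, that is, if $k(D_n)$ is $k$-rational, then $k(R^{ab})^{D_n}$ is $k$-rational. In particular, if some extension field of $k$ contains a primitive $n$-th root of unity $\zeta_n$ with $\zeta_n+\zeta_n^{-1}\in k$, then $k(D_n)$ and $k(R^{ab})^{D_n}$ are both $k$-rational. 4. If $K/k$ is a finite Galois extension and $D_n$ acts on $K$ through an isomorphism $D_n\cong\mathrm{Gal}(K/k)$, then $K(R^{ab})^{D_n}$ is $k$-rational. -/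

import Mathlib

noncomputable section

open Function

/-! ### Relation modules -/

section RelationModule

variable {F G : Type*} [Group F] [Group G]

/-- The relation module `R^ab = R / [R, R]`, written additively, of a homomorphism `ε : F → G`
with kernel `R`. -/
abbrev RelationModule (ε : F →* G) : Type _ := Additive (Abelianization ε.ker)

/-- The action of `F` on `R^ab` that is induced by the conjugation action
`x ↦ (r ↦ x * r * x⁻¹)` of `F` on `R = ker ε`. -/
def relationModuleConj (ε : F →* G) : Representation ℤ F (RelationModule ε) where
  toFun x := (MonoidHom.toAdditive
    (MulAut.conjNormal (H := ε.ker) x).abelianizationCongr.toMonoidHom).toIntLinearMap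
  map_one' := by
    ext a
    induction a using Additive.rec with | _ a
    induction a using QuotientGroup.induction_on with | _ r
    change Additive.ofMul (Abelianization.of (MulAut.conjNormal (1 : F) r)) = _
    rw [map_one]; rfl
  map_mul' x y := by
    ext a
    induction a using Additive.rec with | _ a
    induction a using QuotientGroup.induction_on with | _ r
    change Additive.ofMul (Abelianization.of (MulAut.conjNormal (x * y) r)) = _
    rw [map_mul]; rfl

/-- `R` acts trivially on `R^ab`. -/
theorem ker_le_ker_relationModuleConj (ε : F →* G) : ε.ker ≤ (relationModuleConj ε).ker := by
  intro x hx
  rw [MonoidHom.mem_ker]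
  ext a
  induction a using Additive.rec with | _ a
  induction a using QuotientGroup.induction_on with | _ r
  change Additive.ofMul (Abelianization.of (MulAut.conjNormal x r)) =
    Additive.ofMul (Abelianization.of r)
  have h : MulAut.conjNormal x r = (⟨x, hx⟩ : ε.ker) * r * (⟨x, hx⟩ : ε.ker)⁻¹ := by
    ext; simp
  have h' : Abelianization.of (MulAut.conjNormal x r) = Abelianization.of r := by
    rw [h, map_mul, map_mul, map_inv, mul_right_comm, mul_inv_cancel, one_mul]
  rw [h']

/-- For a surjective `ε : F → G`, the action of `G ≅ F / R` on `R^ab` that is induced by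
conjugation. -/
def relationModuleRep (ε : F →* G) (hε : Surjective ε) : Representation ℤ G (RelationModule ε) :=
  (QuotientGroup.lift ε.ker (relationModuleConj ε) (ker_le_ker_relationModuleConj ε)).comp
    (QuotientGroup.quotientKerEquivOfSurjective ε hε).symm.toMonoidHom

theorem relationModuleRep_apply (ε : F →* G) (hε : Surjective ε) (x : F) (r : ε.ker) :
    relationModuleRep ε hε (ε x) (Additive.ofMul (Abelianization.of r)) =
      Additive.ofMul (Abelianization.of (MulAut.conjNormal x r)) := by
  have h : (QuotientGroup.quotientKerEquivOfSurjective ε hε).symm (ε x) = (x : F ⧸ ε.ker) := by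
    rw [MulEquiv.symm_apply_eq]; rfl
  change QuotientGroup.lift ε.ker (relationModuleConj ε) (ker_le_ker_relationModuleConj ε)
    ((QuotientGroup.quotientKerEquivOfSurjective ε hε).symm (ε x)) _ = _
  rw [h]; rfl

instance [IsFreeGroup F] (ε : F →* G) : Module.Free ℤ (RelationModule ε) :=
  Module.Free.of_equiv
    ((FreeAbelianGroup.equivFinsupp (IsFreeGroup.Generators ε.ker)).symm.trans
      (MulEquiv.toAdditive
        (IsFreeGroup.toFreeGroup ε.ker).symm.abelianizationCongr)).toIntLinearEquiv

end RelationModule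

/-! ### Multiplicative actions -/

section Multiplicative

/-- For a lattice `M = ⨁ ℤ eᵢ` and a field `K`, the field `K(M)`: the fraction field of the group
ring `K[M]`. The element `xᵢ` of `K(M)` is the class of `eᵢ` in `K[M]`, so that `K[M]` is the ring
of Laurent polynomials and `K(M)` the field of rational functions in the variables `xᵢ` over `K`. -/
abbrev LatticeField (K M : Type*) [Field K] [AddCommGroup M] : Type _ :=
  FractionRing (AddMonoidAlgebra K M)

variable {k K M G : Type*} [Field k] [Field K] [Algebra k K] [AddCommGroup M] [Group G]

instance uniqueSums_of_free (M : Type*) [AddCommGroup M] [Module.Free ℤ M] : UniqueSums M :=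
  (AddEquiv.uniqueSums_iff (Module.Free.chooseBasis ℤ M).repr.toAddEquiv).mpr inferInstance

/-- The automorphism of the abelian group `M` given by an element of `G`. -/
def repAddEquiv (π : Representation ℤ G M) (g : G) : M ≃+ M where
  toFun := π g
  invFun := π g⁻¹
  left_inv m := by rw [← Module.End.mul_apply, ← map_mul]; simp
  right_inv m := by rw [← Module.End.mul_apply, ← map_mul]; simp
  map_add' := map_add _

/-- The semilinear action of `G` on the group ring `K[M]`, through `ρ` on the coefficients and
through `π` on the exponents. -/
def latticeRingAction (ρ : G →* Gal(K/k)) (π : Representation ℤ G M) :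
    G →* (AddMonoidAlgebra K M ≃ₐ[k] AddMonoidAlgebra K M) where
  toFun g := (AddMonoidAlgebra.mapAlgEquiv k M (ρ g)).trans
    (AddMonoidAlgebra.domCongr k K (repAddEquiv π g))
  map_one' := by
    apply AlgEquiv.ext
    intro x
    induction x using AddMonoidAlgebra.induction_linear with
    | zero => simp
    | add x y hx hy => rw [map_add, map_add, hx, hy]
    | single m a => simp [repAddEquiv]
  map_mul' g h := by
    apply AlgEquiv.ext
    intro x
    induction x using AddMonoidAlgebra.induction_linear with
    | zero => simp
    | add x y hx hy => rw [map_add, map_add, hx, hy]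
    | single m a => simp [repAddEquiv]

theorem latticeRingAction_single (ρ : G →* Gal(K/k)) (π : Representation ℤ G M) (g : G) (m : M)
    (a : K) :
    latticeRingAction ρ π g (AddMonoidAlgebra.single m a) =
      AddMonoidAlgebra.single (π g m) (ρ g a) := by
  simp [latticeRingAction, repAddEquiv]

/-- The action of `G` on `K(M)` by `k`-automorphisms for which `G` acts on `K` through `ρ` and
`g • xⱼ = ∏ᵢ xᵢ ^ aᵢⱼ` if `π g eⱼ = ∑ᵢ aᵢⱼ eᵢ`. -/
def latticeFieldAction [Module.Free ℤ M] (ρ : G →* Gal(K/k)) (π : Representation ℤ G M) :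
    G →* Gal(LatticeField K M/k) :=
  (IsFractionRing.fieldEquivOfAlgEquivHom k (LatticeField K M)).comp (latticeRingAction ρ π)

theorem latticeFieldAction_single [Module.Free ℤ M] (ρ : G →* Gal(K/k))
    (π : Representation ℤ G M) (g : G) (m : M) (a : K) :
    latticeFieldAction ρ π g
        (algebraMap _ (LatticeField K M) (AddMonoidAlgebra.single m a)) =
      algebraMap _ (LatticeField K M) (AddMonoidAlgebra.single (π g m) (ρ g a)) := by
  simp [latticeFieldAction, latticeRingAction_single]

/-- The fixed field `K(M)^G`. -/
def latticeFixedField [Module.Free ℤ M] (ρ : G →* Gal(K/k)) (π : Representation ℤ G M) :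
    IntermediateField k (LatticeField K M) :=
  IntermediateField.fixedField (latticeFieldAction ρ π).range

end Multiplicative

/-! ### Rationality and Noether's problem -/

/-- `L` is rational over `k`: for some `n`, it is `k`-isomorphic to the rational function field
`k(X₁, …, Xₙ)`. -/
def IsRationalField (k L : Type*) [Field k] [Field L] [Algebra k L] : Prop :=
  ∃ n : ℕ, Nonempty (L ≃ₐ[k] FractionRing (MvPolynomial (Fin n) k))

/-- The action of `G` on the polynomial ring `k[x_g : g ∈ G]` by `h • x_g = x_{hg}`. -/
def noetherRingAction (k G : Type*) [Field k] [Group G] :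
    G →* (MvPolynomial G k ≃ₐ[k] MvPolynomial G k) where
  toFun h := MvPolynomial.renameEquiv k (Equiv.mulLeft h)
  map_one' := by ext; simp
  map_mul' g h := by ext; simp [mul_assoc]

/-- The action of `G` on the rational function field `k(x_g : g ∈ G)` by `h • x_g = x_{hg}`. -/
def noetherAction (k G : Type*) [Field k] [Group G] :
    G →* Gal(FractionRing (MvPolynomial G k)/k) :=
  (IsFractionRing.fieldEquivOfAlgEquivHom k (FractionRing (MvPolynomial G k))).comp
    (noetherRingAction k G)

theorem noetherAction_X (k G : Type*) [Field k] [Group G] (h g : G) :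
    noetherAction k G h (algebraMap (MvPolynomial G k) (FractionRing (MvPolynomial G k)) (MvPolynomial.X g)) =
      algebraMap (MvPolynomial G k) (FractionRing (MvPolynomial G k)) (MvPolynomial.X (h * g)) := by
  simp [noetherAction, noetherRingAction]

/-- The field `k(G) = k(x_g : g ∈ G)^G` of Noether's problem. -/
def noetherField (k G : Type*) [Field k] [Group G] :
    IntermediateField k (FractionRing (MvPolynomial G k)) :=
  IntermediateField.fixedField (noetherAction k G).range

/-! ### The dihedral group -/

/-- The homomorphism from the free group on `s₁, s₂` to the dihedral group `Dₙ` of order `2n` with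
`s₁ ↦ σ` and `s₂ ↦ τ`, where `σ = r 1` is a rotation of order `n` and `τ = sr 0` a reflection. -/
def dihedralPresentation (n : ℕ) : FreeGroup (Fin 2) →* DihedralGroup n :=
  FreeGroup.lift ![DihedralGroup.r 1, DihedralGroup.sr 0]

theorem dihedralPresentation_surjective (n : ℕ) : Surjective (dihedralPresentation n) := by
  have h0 : dihedralPresentation n (FreeGroup.of 0) = DihedralGroup.r 1 := by
    simp [dihedralPresentation]
  have h1 : dihedralPresentation n (FreeGroup.of 1) = DihedralGroup.sr 0 := by
    simp [dihedralPresentation]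
  rintro (i | i)
  · obtain ⟨j, rfl⟩ := ZMod.intCast_surjective i
    exact ⟨FreeGroup.of 0 ^ j, by rw [map_zpow, h0, DihedralGroup.r_one_zpow]⟩
  · obtain ⟨j, rfl⟩ := ZMod.intCast_surjective i
    refine ⟨FreeGroup.of 1 * FreeGroup.of 0 ^ j, ?_⟩
    rw [map_mul, map_zpow, h0, h1, DihedralGroup.r_one_zpow, DihedralGroup.sr_mul_r, zero_add]

/-- The relation module `R^ab` of the presentation `1 → R → ⟨s₁, s₂⟩ → Dₙ → 1`, with its action
of `Dₙ`. -/
def dihedralRelationRep (n : ℕ) :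
    Representation ℤ (DihedralGroup n) (RelationModule (dihedralPresentation n)) :=
  relationModuleRep (dihedralPresentation n) (dihedralPresentation_surjective n)

end

/-!
# The relation module of the dihedral group and Noether's problem

The Cayley complex of the presentation `⟨s₁, s₂ | s₁ⁿ, s₂², (s₁ s₂)²⟩` of `Dₙ` is a sphere, on which
`Dₙ` acts by rotations. Hence `R^ab` is generated by the classes of its faces, and the only relation
says that the faces, suitably oriented, add up to zero: with `a, a'` the two conjugates of `[s₁ⁿ]`,
`b_c` those of `[s₂²]` and `d_c` those of `[(s₁ s₂)²]`, where `c ∈ ℤ/n`,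
`a + a' + ∑ b_c = ∑ d_c` (`rotationClass_add_rotationClass'`). The classes `a`, `b_c`, `d_c` form a
`ℤ`-basis: they generate because the relators whose class is in their span form a normal subgroup
(`span_relationBasis`), and they are independent because the Magnus embedding of `R^ab` into the
edge space of the Cayley graph separates them (`linearIndependent_relationBasis`).

Let `A, A', B_c, D_c` be the corresponding elements of `Ω = k'(R^ab)`. Put `s = ∑ D_c`, and
`U = A / s^((n-1)/2)`, `U' = A' / s^((n-1)/2)`, `V_c = D_c / s`. The group permutes `U, U'` and the
`V_c`, and `∑ V_c = 1`. Since `n` is odd, the relation becomes `U U' ∏ B_c = s ∏ V_c`, so `s` is a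
rational function of the `B_c, U, U', V_c`, which therefore generate `Ω`
(`adjoin_relationGenerator`). The monomial action has become an affine one, and the no-name lemma
applies (`fixedField_equiv_of_stable_subspace`): if `G` acts faithfully on a field `L ⊆ Ω` and `Ω`
is generated by a `G`-stable `L`-space that contains `1` and has dimension at most
`trdeg_L Ω + 1`, then `Ω^G` is purely transcendental over `L^G`. It rests on Galois descent for
vector spaces.

* With `L = k'(B_c)`, the field `k'(R^ab)^{Dₙ}` is purely transcendental of degree `n + 1` over
  `L^{Dₙ}`. In `k'(x_g : g ∈ Dₙ)` the coset sums `x_{σᶜ} + x_{σᶜτ}` generate an isomorphic field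
  `L`, over which the no-name lemma gives degree `n`. This proves
  `k'(R^ab)^{Dₙ} ≅ k'(ℤ[Dₙ])^{Dₙ}(t)`, and the same with `k(Dₙ)`.
* If `Dₙ` is the Galois group of `K/k`, take `L = K`, with `L^{Dₙ} = k`.
* If `ζ + ζ⁻¹ ∈ k`, the regular representation contains a two-dimensional one, with basis
  `ℓ₀, ℓ₁`, on whose projective line `Dₙ` acts faithfully. Take `L = k(ℓ₁ / ℓ₀)`; then `L^{Dₙ}` is
  rational by Lüroth's theorem (`isRationalField_fixedField_regular`).
-/

noncomputable section

open Function

/-! ### Invariants of semilinear actions on function fields -/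

section Invariants

variable {k L Ω G : Type*} [Field k] [Field L] [Field Ω] [Algebra k L] [Algebra k Ω] [Algebra L Ω]
  [Group G]

theorem mem_fixedField_range {E : Type*} [Field E] [Algebra k E] (a : G →* Gal(E/k)) {x : E} :
    x ∈ IntermediateField.fixedField a.range ↔ ∀ g, a g x = x := by
  rw [IntermediateField.mem_fixedField_iff]
  constructor
  · exact fun h g => h _ ⟨g, rfl⟩
  · rintro h _ ⟨g, rfl⟩
    exact h g

theorem map_aeval_of_invariant {ι : Type*} (aL : G →* Gal(L/k)) (aΩ : G →* Gal(Ω/k))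
    (hcompat : ∀ g x, aΩ g (algebraMap L Ω x) = algebraMap L Ω (aL g x))
    {z : ι → Ω} (hinv : ∀ g i, aΩ g (z i) = z i) (g : G) (P : MvPolynomial ι L) :
    aΩ g (MvPolynomial.aeval z P) =
      MvPolynomial.aeval z (MvPolynomial.map (aL g : L →+* L) P) := by
  induction P using MvPolynomial.induction_on with
  | C a => simp [hcompat]
  | add p q hp hq => simp only [map_add, hp, hq]
  | mul_X p i hp => simp only [map_mul, hp, MvPolynomial.aeval_X, MvPolynomial.map_X, hinv]

theorem aeval_mem_adjoin_fixedField {ι : Type*} (aL : G →* Gal(L/k)) (aΩ : G →* Gal(Ω/k))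
    (hcompat : ∀ g x, aΩ g (algebraMap L Ω x) = algebraMap L Ω (aL g x))
    {z : ι → Ω} (hz : AlgebraicIndependent L z) (hinv : ∀ g i, aΩ g (z i) = z i)
    {P : MvPolynomial ι L} (hP : ∀ g, aΩ g (MvPolynomial.aeval z P) = MvPolynomial.aeval z P) :
    MvPolynomial.aeval z P ∈
      IntermediateField.adjoin (IntermediateField.fixedField aL.range) (Set.range z) := by
  have hcoeff : ∀ m, P.coeff m ∈ IntermediateField.fixedField aL.range := by
    intro m
    rw [mem_fixedField_range]
    intro g
    have h := hz.eq_iff.mp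
      ((map_aeval_of_invariant aL aΩ hcompat hinv g P).symm.trans (hP g))
    conv_rhs => rw [← h]
    rw [MvPolynomial.coeff_map]
    rfl
  rw [MvPolynomial.aeval_def, MvPolynomial.eval₂_eq]
  refine sum_mem fun m _ => mul_mem ?_ (prod_mem fun i _ => pow_mem ?_ _)
  · exact (IntermediateField.adjoin (IntermediateField.fixedField aL.range)
      (Set.range z)).algebraMap_mem ⟨_, hcoeff m⟩
  · exact IntermediateField.subset_adjoin _ _ ⟨i, rfl⟩

/-- If `Ω` is generated over `L` by algebraically independent invariant elements, then so is `Ω^G`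
over `L^G`, by the same elements. An invariant fraction is rewritten with an invariant denominator,
the norm of the old one. -/
theorem adjoin_fixedField_eq [IsScalarTower k L Ω] [Finite G] {ι : Type*} (aL : G →* Gal(L/k))
    (aΩ : G →* Gal(Ω/k))
    (hcompat : ∀ g x, aΩ g (algebraMap L Ω x) = algebraMap L Ω (aL g x))
    {z : ι → Ω} (hz : AlgebraicIndependent L z)
    (htop : IntermediateField.adjoin L (Set.range z) = ⊤) (hinv : ∀ g i, aΩ g (z i) = z i) :
    (IntermediateField.adjoin (IntermediateField.fixedField aL.range)
      (Set.range z)).restrictScalars k = IntermediateField.fixedField aΩ.range := by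
  have := Fintype.ofFinite G
  classical
  apply le_antisymm
  · intro x hx
    rw [IntermediateField.mem_restrictScalars] at hx
    rw [mem_fixedField_range]
    intro g
    induction hx using IntermediateField.adjoin_induction with
    | mem x hx => obtain ⟨i, rfl⟩ := hx; exact hinv g i
    | algebraMap x =>
      change aΩ g (algebraMap L Ω x) = algebraMap L Ω x
      rw [hcompat, (mem_fixedField_range aL).mp x.2 g]
    | add x y _ _ hx hy => rw [map_add, hx, hy]
    | inv x _ hx => rw [map_inv₀, hx]
    | mul x y _ _ hx hy => rw [map_mul, hx, hy]
  · intro f hf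
    rw [IntermediateField.mem_restrictScalars]
    rw [mem_fixedField_range] at hf
    have hf' : f ∈ IntermediateField.adjoin L (Set.range z) := htop ▸ IntermediateField.mem_top
    obtain ⟨r, s, hrs⟩ := (IntermediateField.mem_adjoin_range_iff L z f).mp hf'
    by_cases hs : MvPolynomial.aeval z s = 0
    · rw [hrs, hs, div_zero]; exact zero_mem _
    set N : MvPolynomial ι L := ∏ g : G, MvPolynomial.map (aL g : L →+* L) s with hN
    set M : MvPolynomial ι L :=
      r * ∏ g ∈ Finset.univ.erase (1 : G), MvPolynomial.map (aL g : L →+* L) s with hM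
    have hNprod : MvPolynomial.aeval z N = ∏ g : G, aΩ g (MvPolynomial.aeval z s) := by
      rw [hN, map_prod]
      exact Finset.prod_congr rfl fun g _ =>
        (map_aeval_of_invariant aL aΩ hcompat hinv g s).symm
    have hN0 : MvPolynomial.aeval z N ≠ 0 := by
      rw [hNprod, Finset.prod_ne_zero_iff]
      exact fun g _ => by simpa using hs
    have hNinv : ∀ h, aΩ h (MvPolynomial.aeval z N) = MvPolynomial.aeval z N := by
      intro h
      rw [hNprod, map_prod]
      refine Fintype.prod_equiv (Equiv.mulLeft h) _ _ fun g => ?_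
      rw [Equiv.coe_mulLeft, map_mul]
      rfl
    have hMN : MvPolynomial.aeval z M = f * MvPolynomial.aeval z N := by
      rw [hM, hN, ← Finset.mul_prod_erase _ _ (Finset.mem_univ (1 : G)), map_mul, map_mul, hrs,
        ← map_aeval_of_invariant aL aΩ hcompat hinv 1 s]
      simp only [map_one, AlgEquiv.one_apply]
      field_simp
    have hMinv : ∀ h, aΩ h (MvPolynomial.aeval z M) = MvPolynomial.aeval z M := by
      intro h
      rw [hMN, map_mul, hf, hNinv]
    have hf2 : f = MvPolynomial.aeval z M / MvPolynomial.aeval z N := by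
      rw [hMN]; field_simp
    rw [hf2]
    exact div_mem (aeval_mem_adjoin_fixedField aL aΩ hcompat hz hinv hMinv)
      (aeval_mem_adjoin_fixedField aL aΩ hcompat hz hinv hNinv)

theorem fixedField_equiv_of_invariant_generators [IsScalarTower k L Ω] [Finite G] {ι : Type*}
    (aL : G →* Gal(L/k)) (aΩ : G →* Gal(Ω/k))
    (hcompat : ∀ g x, aΩ g (algebraMap L Ω x) = algebraMap L Ω (aL g x))
    {z : ι → Ω} (hz : AlgebraicIndependent L z)
    (htop : IntermediateField.adjoin L (Set.range z) = ⊤) (hinv : ∀ g i, aΩ g (z i) = z i) :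
    Nonempty (IntermediateField.fixedField aΩ.range ≃ₐ[k]
      FractionRing (MvPolynomial ι (IntermediateField.fixedField aL.range))) := by
  have hz0 : AlgebraicIndependent (IntermediateField.fixedField aL.range) z :=
    hz.restrictScalars (algebraMap (IntermediateField.fixedField aL.range) L).injective
  have e := hz0.aevalEquivField
  refine ⟨(IntermediateField.equivOfEq
    (adjoin_fixedField_eq aL aΩ hcompat hz htop hinv).symm).trans ?_⟩
  exact (e.restrictScalars k).symm

/-- Galois descent for a `G`-stable `L`-subspace `V` of `Ω`: if `G` acts faithfully on `L`, then
`V` is spanned by its invariants. A functional that kills all traces `∑ g (a • v)`, `a ∈ L`,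
kills `v`, by the linear independence of the automorphisms `aL g`. -/
theorem le_span_invariants [Finite G] (aL : G →* Gal(L/k)) (aΩ : G →* Gal(Ω/k))
    (hcompat : ∀ g x, aΩ g (algebraMap L Ω x) = algebraMap L Ω (aL g x))
    (hfaith : Injective aL) (V : Submodule L Ω) (hV : ∀ g, ∀ v ∈ V, aΩ g v ∈ V) :
    V ≤ Submodule.span L {v | v ∈ V ∧ ∀ g, aΩ g v = v} := by
  have := Fintype.ofFinite G
  intro v hv
  by_contra hnot
  obtain ⟨f, hfv, hf⟩ := Submodule.exists_le_ker_of_notMem hnot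
  have hsmul : ∀ g (a : L) (x : Ω), aΩ g (a • x) = aL g a • aΩ g x := by
    intro g a x
    rw [Algebra.smul_def, Algebra.smul_def, map_mul, hcompat]
  have htrace : ∀ a : L, ∑ g, f (aΩ g v) * aL g a = 0 := by
    intro a
    have hmem : ∑ g, aΩ g (a • v) ∈ Submodule.span L {v | v ∈ V ∧ ∀ g, aΩ g v = v} := by
      refine Submodule.subset_span ⟨sum_mem fun g _ => hV g _ (V.smul_mem a hv), fun h => ?_⟩
      rw [map_sum]
      refine Fintype.sum_equiv (Equiv.mulLeft h) _ _ fun g => ?_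
      rw [Equiv.coe_mulLeft, map_mul]
      rfl
    have h := LinearMap.mem_ker.mp (hf hmem)
    rw [map_sum] at h
    rw [← h]
    refine Finset.sum_congr rfl fun g _ => ?_
    rw [hsmul, map_smul, smul_eq_mul, mul_comm]
  have hli : LinearIndependent L fun g : G => ((aL g : L →* L) : L → L) := by
    refine (linearIndependent_monoidHom L L).comp (fun g : G => (aL g : L →* L)) fun g h hgh => ?_
    exact hfaith (AlgEquiv.ext fun x => DFunLike.congr_fun hgh x)
  have h1 := Fintype.linearIndependent_iff.mp hli (fun g => f (aΩ g v)) (by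
    funext a
    simpa using htrace a) 1
  exact hfv (by simpa using h1)

theorem isAlgebraic_algebraAdjoin_of_adjoin_eq_top {F E : Type*} [Field F] [Field E] [Algebra F E]
    {S : Set E} (htop : IntermediateField.adjoin F S = ⊤) :
    Algebra.IsAlgebraic (Algebra.adjoin F S) E := by
  have : IsFractionRing (Algebra.adjoin F S) E := .of_field _ _ fun x => by
    have hx : x ∈ IntermediateField.adjoin F S := htop ▸ IntermediateField.mem_top
    obtain ⟨r, hr, s, hs, eq⟩ := IntermediateField.mem_adjoin_iff_div.mp hx
    exact ⟨⟨r, hr⟩, ⟨s, hs⟩, eq⟩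
  exact IsLocalization.isAlgebraic _ (nonZeroDivisors (Algebra.adjoin F S))

theorem trdeg_le_card_of_adjoin_eq_top {F E ι : Type*} [Field F] [Field E] [Algebra F E]
    [Finite ι] {z : ι → E} (htop : IntermediateField.adjoin F (Set.range z) = ⊤) :
    Algebra.trdeg F E ≤ (Nat.card ι : Cardinal) := by
  have := isAlgebraic_algebraAdjoin_of_adjoin_eq_top htop
  refine (Algebra.IsAlgebraic.trdeg_le_cardinalMk F (Set.range z)).trans ?_
  rw [← Nat.cast_card, Nat.card_coe_set_eq, ← Set.image_univ]
  exact_mod_cast (Set.ncard_image_le Set.finite_univ).trans (Set.ncard_univ ι).le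

theorem algebraicIndependent_of_card_le_trdeg {F E ι : Type*} [Field F] [Field E] [Algebra F E]
    [Finite ι] {z : ι → E} (htop : IntermediateField.adjoin F (Set.range z) = ⊤)
    (hcard : (Nat.card ι : Cardinal) ≤ Algebra.trdeg F E) : AlgebraicIndependent F z := by
  have := isAlgebraic_algebraAdjoin_of_adjoin_eq_top htop
  refine (Algebra.IsAlgebraic.isTranscendenceBasis_of_lift_le_trdeg_of_finite F z ?_).1
  rw [← Nat.cast_card]
  simpa using hcard

/-- The no-name lemma for affine actions. The invariants of `V` contain an `L`-basis of `V` that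
extends `1 ∈ V`; the other basis elements generate `Ω` over `L`, and are algebraically independent
because their number is at most the transcendence degree. -/
theorem fixedField_equiv_of_stable_subspace [IsScalarTower k L Ω] [Finite G]
    (aL : G →* Gal(L/k)) (aΩ : G →* Gal(Ω/k))
    (hcompat : ∀ g x, aΩ g (algebraMap L Ω x) = algebraMap L Ω (aL g x))
    (hfaith : Injective aL) (V : Submodule L Ω) (hV : ∀ g, ∀ v ∈ V, aΩ g v ∈ V)
    (h1 : (1 : Ω) ∈ V) (htop : IntermediateField.adjoin L (V : Set Ω) = ⊤) (d : ℕ)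
    [FiniteDimensional L V] (hdim : Module.finrank L V ≤ d + 1)
    (htrdeg : (d : Cardinal) ≤ Algebra.trdeg L Ω) :
    Nonempty (IntermediateField.fixedField aΩ.range ≃ₐ[k]
      FractionRing (MvPolynomial (Fin d) (IntermediateField.fixedField aL.range))) := by
  obtain ⟨b, hbt, h1b, htb, hb⟩ := exists_linearIndepOn_id_extension (K := L) (V := Ω)
    (s := {1}) (t := {v | v ∈ V ∧ ∀ g, aΩ g v = v})
    (LinearIndepOn.singleton one_ne_zero)
    (by rintro _ rfl; exact ⟨h1, fun g => map_one _⟩)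
  have hbV : b ⊆ V := fun x hx => (hbt hx).1
  have hspan : Submodule.span L b = V :=
    le_antisymm (Submodule.span_le.mpr hbV)
      ((le_span_invariants aL aΩ hcompat hfaith V hV).trans (Submodule.span_le.mpr htb))
  have hbV' : LinearIndependent L (fun x : b => (⟨x, hbV x.2⟩ : V)) :=
    LinearIndependent.of_comp V.subtype hb
  have hbfin : b.Finite := by
    have := hbV'.finite
    exact b.toFinite
  have hbcard : b.ncard ≤ d + 1 := by
    have := hbfin.fintype
    rw [← Nat.card_coe_set_eq, Nat.card_eq_fintype_card]
    exact hbV'.fintype_card_le_finrank.trans hdim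
  have h1b' : (1 : Ω) ∈ b := h1b rfl
  have hcard : Nat.card ↥(b \ {1}) ≤ d := by
    have h := Set.ncard_sdiff_singleton_add_one h1b' hbfin
    rw [Nat.card_coe_set_eq]
    omega
  have : Finite ↥(b \ {1}) := hbfin.sdiff
  have htop' : IntermediateField.adjoin L (Set.range (Subtype.val : ↥(b \ {1}) → Ω)) = ⊤ := by
    rw [Subtype.range_coe, ← top_le_iff, ← htop, IntermediateField.adjoin_le_iff, ← hspan]
    intro x hx
    induction hx using Submodule.span_induction with
    | mem x hx =>
      by_cases hx1 : x = 1
      · rw [hx1]; exact one_mem (IntermediateField.adjoin L (b \ {1}))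
      · exact IntermediateField.subset_adjoin _ _ ⟨hx, hx1⟩
    | zero => exact zero_mem (IntermediateField.adjoin L (b \ {1}))
    | add x y _ _ hx hy => exact add_mem (S := IntermediateField L Ω) hx hy
    | smul a x _ hx => exact (IntermediateField.adjoin L (b \ {1})).smul_mem hx
  have hind := algebraicIndependent_of_card_le_trdeg htop'
    ((Nat.cast_le.mpr hcard).trans htrdeg)
  have hcard' : Nat.card ↥(b \ {1}) = d := by
    refine le_antisymm hcard ?_
    exact_mod_cast htrdeg.trans (trdeg_le_card_of_adjoin_eq_top htop')
  obtain ⟨e⟩ : Nonempty (Fin d ≃ ↥(b \ {1})) := ⟨(Finite.equivFinOfCardEq hcard').symm⟩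
  refine fixedField_equiv_of_invariant_generators aL aΩ hcompat (z := fun i => (e i : Ω))
    (hind.comp e e.injective) ?_ fun g i => (hbt (e i).2.1).2 g
  rw [← htop']
  congr 1
  exact e.surjective.range_comp Subtype.val

end Invariants

/-! ### Purely transcendental extensions -/

section PurelyTranscendental

/-- The family `x` is algebraically independent over `k` and generates the field `E` over `k`, so
that `E` is the field of rational functions over `k` in the variables `x`. -/
structure IsRationalBasis (k : Type*) {E ι : Type*} [Field k] [Field E] [Algebra k E]
    (x : ι → E) : Prop where
  indep : AlgebraicIndependent k x
  adjoin_eq_top : IntermediateField.adjoin k (Set.range x) = ⊤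

variable {k E Ω ι κ : Type*} [Field k] [Field E] [Field Ω] [Algebra k E]

theorem IsRationalBasis.nonempty_equiv {x : ι → E} (hx : IsRationalBasis k x) :
    Nonempty (E ≃ₐ[k] FractionRing (MvPolynomial ι k)) :=
  ⟨(hx.indep.aevalEquivField.trans ((IntermediateField.equivOfEq hx.adjoin_eq_top).trans
    IntermediateField.topEquiv)).symm⟩

theorem IsRationalBasis.comp_equiv {x : ι → E} (hx : IsRationalBasis k x) (e : κ ≃ ι) :
    IsRationalBasis k (x ∘ e) :=
  ⟨hx.indep.comp e e.injective, by rw [e.surjective.range_comp, hx.adjoin_eq_top]⟩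

theorem IsRationalBasis.isTranscendenceBasis {x : ι → E} (hx : IsRationalBasis k x) :
    IsTranscendenceBasis k x := by
  have := isAlgebraic_algebraAdjoin_of_adjoin_eq_top hx.adjoin_eq_top
  exact hx.indep.isTranscendenceBasis_iff_isAlgebraic.mpr this

theorem IsRationalBasis.trdeg [Finite ι] {x : ι → E} (hx : IsRationalBasis k x) :
    Algebra.trdeg k E = (Nat.card ι : Cardinal) := by
  have h := hx.isTranscendenceBasis.lift_cardinalMk_eq_trdeg
  rw [← Nat.cast_card, Cardinal.lift_natCast] at h
  exact Cardinal.lift_eq_nat_iff.mp h.symm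

theorem IsRationalBasis.map [Algebra k Ω] {x : ι → E} (hx : IsRationalBasis k x) (e : E ≃ₐ[k] Ω) :
    IsRationalBasis k (e ∘ x) := by
  refine ⟨hx.indep.map' (f := e.toAlgHom) e.injective, ?_⟩
  have h := IntermediateField.adjoin_map k (Set.range x) e.toAlgHom
  rw [hx.adjoin_eq_top] at h
  rw [Set.range_comp]
  refine h.symm.trans ?_
  rw [← AlgHom.fieldRange_eq_map, AlgHom.fieldRange_eq_top]
  exact e.surjective

theorem isRationalBasis_X (k ι : Type*) [Field k] :
    IsRationalBasis k fun i : ι =>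
      algebraMap (MvPolynomial ι k) (FractionRing (MvPolynomial ι k)) (MvPolynomial.X i) := by
  refine ⟨(MvPolynomial.algebraicIndependent_X ι k).map'
    (f := Algebra.ofId _ _ |>.restrictScalars k) (IsFractionRing.injective _ _), ?_⟩
  rw [← top_le_iff]
  intro f _
  obtain ⟨p, q, _, rfl⟩ := IsFractionRing.div_surjective (A := MvPolynomial ι k) f
  have hmem : ∀ p : MvPolynomial ι k,
      algebraMap (MvPolynomial ι k) (FractionRing (MvPolynomial ι k)) p ∈
        IntermediateField.adjoin k (Set.range fun i : ι => algebraMap (MvPolynomial ι k)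
          (FractionRing (MvPolynomial ι k)) (MvPolynomial.X i)) := by
    intro p
    induction p using MvPolynomial.induction_on with
    | C a =>
      rw [← MvPolynomial.algebraMap_eq, ← IsScalarTower.algebraMap_apply]
      exact IntermediateField.algebraMap_mem _ a
    | add p q hp hq => rw [map_add]; exact add_mem hp hq
    | mul_X p i hp =>
      rw [map_mul]
      exact mul_mem hp (IntermediateField.subset_adjoin _ _ ⟨i, rfl⟩)
  exact div_mem (hmem p) (hmem q)

theorem isRationalBasis_ratFunc_X (k : Type*) [Field k] :
    IsRationalBasis k fun _ : Unit => (RatFunc.X : RatFunc k) := by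
  refine ⟨algebraicIndependent_unique_type_iff.mpr RatFunc.transcendental_X, ?_⟩
  rw [Set.range_const]
  exact RatFunc.adjoin_X

theorem ratFunc_equiv_congr [Algebra k Ω] (e : E ≃ₐ[k] Ω) : Nonempty (RatFunc E ≃ₐ[k] RatFunc Ω) :=
  ⟨IsFractionRing.fieldEquivOfAlgEquiv k (RatFunc E) (RatFunc Ω) (Polynomial.mapAlgEquiv e)⟩

theorem fractionRing_mvPolynomial_equiv_congr (ι : Type*) [Algebra k Ω] (e : E ≃ₐ[k] Ω) :
    Nonempty (FractionRing (MvPolynomial ι E) ≃ₐ[k] FractionRing (MvPolynomial ι Ω)) :=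
  ⟨IsFractionRing.fieldEquivOfAlgEquiv k _ _ (MvPolynomial.mapAlgEquiv ι e)⟩

variable [Algebra k Ω] [Algebra E Ω] [IsScalarTower k E Ω]

theorem IsRationalBasis.sumElim {x : ι → E} (hx : IsRationalBasis k x) {y : κ → Ω}
    (hy : IsRationalBasis E y) : IsRationalBasis k (Sum.elim y (algebraMap E Ω ∘ x)) := by
  refine ⟨hx.indep.sumElim_comp hy.indep, ?_⟩
  set T := IntermediateField.adjoin k (Set.range (Sum.elim y (algebraMap E Ω ∘ x))) with hT
  have hE : ∀ a : E, algebraMap E Ω a ∈ T := by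
    intro a
    have ha : a ∈ IntermediateField.adjoin k (Set.range x) :=
      hx.adjoin_eq_top ▸ IntermediateField.mem_top
    induction ha using IntermediateField.adjoin_induction with
    | mem a ha =>
      obtain ⟨i, rfl⟩ := ha
      exact IntermediateField.subset_adjoin _ _ ⟨Sum.inr i, rfl⟩
    | algebraMap a => rw [← IsScalarTower.algebraMap_apply]; exact T.algebraMap_mem a
    | add a b _ _ ha hb => rw [map_add]; exact add_mem ha hb
    | inv a _ ha => rw [map_inv₀]; exact inv_mem ha
    | mul a b _ _ ha hb => rw [map_mul]; exact mul_mem ha hb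
  rw [← top_le_iff]
  intro f _
  have hf : f ∈ IntermediateField.adjoin E (Set.range y) :=
    hy.adjoin_eq_top ▸ IntermediateField.mem_top
  induction hf using IntermediateField.adjoin_induction with
  | mem a ha =>
    obtain ⟨i, rfl⟩ := ha
    exact IntermediateField.subset_adjoin _ _ ⟨Sum.inl i, rfl⟩
  | algebraMap a => exact hE a
  | add a b _ _ ha hb => exact add_mem (ha trivial) (hb trivial)
  | inv a _ ha => exact inv_mem (ha trivial)
  | mul a b _ _ ha hb => exact mul_mem (ha trivial) (hb trivial)

theorem IsRationalBasis.isRationalField [Finite ι] {x : ι → E} (hx : IsRationalBasis k x) :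
    IsRationalField k E :=
  ⟨Nat.card ι, (hx.comp_equiv (Finite.equivFin ι).symm).nonempty_equiv⟩

omit [Algebra E Ω] [IsScalarTower k E Ω] in
theorem IsRationalField.congr (h : IsRationalField k E) (e : Ω ≃ₐ[k] E) : IsRationalField k Ω := by
  obtain ⟨n, ⟨f⟩⟩ := h
  exact ⟨n, ⟨e.trans f⟩⟩

omit [Algebra E Ω] [IsScalarTower k E Ω] in
theorem IsRationalField.of_isRationalBasis (h : IsRationalField k E) [Algebra E Ω]
    [IsScalarTower k E Ω] [Finite κ] {y : κ → Ω} (hy : IsRationalBasis E y) :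
    IsRationalField k Ω := by
  obtain ⟨n, ⟨f⟩⟩ := h
  exact (((isRationalBasis_X k (Fin n)).map f.symm).sumElim hy).isRationalField

theorem IsRationalField.mvPolynomial (h : IsRationalField k E) (d : ℕ) :
    IsRationalField k (FractionRing (MvPolynomial (Fin d) E)) :=
  h.of_isRationalBasis (isRationalBasis_X E (Fin d))

theorem IsRationalField.ratFunc (h : IsRationalField k E) : IsRationalField k (RatFunc E) :=
  h.of_isRationalBasis (isRationalBasis_ratFunc_X E)

theorem ratFunc_fractionRing_equiv (k E : Type*) [Field k] [Field E] [Algebra k E] (n : ℕ) :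
    Nonempty (RatFunc (FractionRing (MvPolynomial (Fin n) E)) ≃ₐ[k]
      FractionRing (MvPolynomial (Fin (n + 1)) E)) := by
  obtain ⟨e⟩ := (((isRationalBasis_X E (Fin n)).sumElim
    (isRationalBasis_ratFunc_X (FractionRing (MvPolynomial (Fin n) E)))).comp_equiv
    (Fintype.equivOfCardEq (by simp [add_comm]) : Fin (n + 1) ≃ Unit ⊕ Fin n)).nonempty_equiv
  exact ⟨e.restrictScalars k⟩

end PurelyTranscendental

/-! ### Relation modules: classes of relators and the Magnus embedding -/

section RelClass

variable {F G : Type*} [Group F] [Group G]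

/-- The class in `R^ab` of an element of `R = ker ε`. -/
def relClass (ε : F →* G) (r : ε.ker) : RelationModule ε := Additive.ofMul (Abelianization.of r)

theorem relClass_mul (ε : F →* G) (r r' : ε.ker) :
    relClass ε (r * r') = relClass ε r + relClass ε r' := by
  simp [relClass]

theorem relClass_one (ε : F →* G) : relClass ε 1 = 0 := by
  simp [relClass]

theorem relClass_inv (ε : F →* G) (r : ε.ker) : relClass ε r⁻¹ = -relClass ε r := by
  simp [relClass]

theorem relClass_surjective (ε : F →* G) : Surjective (relClass ε) := by
  intro a
  induction a using Additive.rec with | _ a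
  induction a using QuotientGroup.induction_on with | _ r
  exact ⟨r, rfl⟩

theorem relationModuleRep_relClass (ε : F →* G) (hε : Surjective ε) (x : F) (r r' : ε.ker)
    (h : (r' : F) = x * r * x⁻¹) :
    relationModuleRep ε hε (ε x) (relClass ε r) = relClass ε r' := by
  have : r' = MulAut.conjNormal x r := Subtype.ext (by simpa using h)
  rw [this]
  exact relationModuleRep_apply ε hε x r

end RelClass

section Magnus

variable {G ι : Type*} [Group G] [DecidableEq G]

/-- For a weight `f : ι → ℤ` of the generators, the homomorphism from the free group on `ι` to the
wreath product of `ℤ` and `G` that lifts `ε`. Its first component sends a word to the function on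
`G` that counts, with weights and signs, the edges of the Cayley graph of `G` starting at each
vertex that are traversed by the path of the word. -/
def cayleyCount (ε : FreeGroup ι →* G) (f : ι → ℤ) :
    FreeGroup ι →* RegularWreathProduct (Multiplicative ℤ) G :=
  FreeGroup.lift fun i => ⟨Pi.mulSingle 1 (Multiplicative.ofAdd (f i)), ε (FreeGroup.of i)⟩

theorem cayleyCount_right (ε : FreeGroup ι →* G) (f : ι → ℤ) (x : FreeGroup ι) :
    (cayleyCount ε f x).right = ε x := by
  have : RegularWreathProduct.rightHom.comp (cayleyCount ε f) = ε := by
    ext i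
    simp [cayleyCount]
  exact DFunLike.congr_fun this x

theorem cayleyCount_of_left (ε : FreeGroup ι →* G) (f : ι → ℤ) (i : ι) (h : G) :
    ((cayleyCount ε f (FreeGroup.of i)).left h).toAdd = if h = 1 then f i else 0 := by
  simp only [cayleyCount, FreeGroup.lift_apply_of, Pi.mulSingle_apply]
  split_ifs <;> simp

theorem cayleyCount_mul_left (ε : FreeGroup ι →* G) (f : ι → ℤ) (x y : FreeGroup ι) (h : G) :
    ((cayleyCount ε f (x * y)).left h).toAdd =
      ((cayleyCount ε f x).left h).toAdd + ((cayleyCount ε f y).left ((ε x)⁻¹ * h)).toAdd := by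
  rw [map_mul, RegularWreathProduct.mul_left, Pi.mul_apply, toAdd_mul, cayleyCount_right]

/-- The coordinate at `h` of the map from `R^ab` to functions on `G` induced by `cayleyCount`. -/
def relationModuleCount (ε : FreeGroup ι →* G) (f : ι → ℤ) (h : G) : RelationModule ε →+ ℤ :=
  MonoidHom.toAdditiveLeft (Abelianization.lift
    { toFun := fun r : ε.ker => (cayleyCount ε f r).left h
      map_one' := by simp
      map_mul' := fun r r' => by
        apply Multiplicative.toAdd.injective
        change ((cayleyCount ε f (r * r')).left h).toAdd = _
        rw [cayleyCount_mul_left, MonoidHom.mem_ker.mp r.2, inv_one, one_mul]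
        rfl })

theorem relationModuleCount_relClass (ε : FreeGroup ι →* G) (f : ι → ℤ) (h : G) (r : ε.ker) :
    relationModuleCount ε f h (relClass ε r) = ((cayleyCount ε f r).left h).toAdd := rfl

theorem relationModuleCount_rep (ε : FreeGroup ι →* G) (hε : Surjective ε) (f : ι → ℤ) (g h : G)
    (m : RelationModule ε) :
    relationModuleCount ε f h (relationModuleRep ε hε g m) =
      relationModuleCount ε f (g⁻¹ * h) m := by
  obtain ⟨x, rfl⟩ := hε g
  obtain ⟨r, rfl⟩ := relClass_surjective ε m
  rw [relationModuleRep_relClass ε hε x r ⟨x * r * x⁻¹, ε.normal_ker.conj_mem _ r.2 x⟩ rfl,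
    relationModuleCount_relClass, relationModuleCount_relClass]
  have h1 := cayleyCount_mul_left ε f (x * r * x⁻¹) x h
  have h2 := cayleyCount_mul_left ε f x r h
  have hr : ε r = 1 := r.2
  have hx : ε (x * r * x⁻¹) = 1 := by simp [hr]
  rw [inv_mul_cancel_right, hx, inv_one, one_mul] at h1
  linarith

end Magnus

/-! ### The relation module of the dihedral group -/

section Dihedral

theorem zpow_mul_eq_mul_zpow_neg {Q : Type*} [Group Q] {a b : Q} (hb : b ^ 2 = 1)
    (hab : (a * b) ^ 2 = 1) (j : ℤ) : a ^ j * b = b * a ^ (-j) := by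
  have h : SemiconjBy b a⁻¹ a := by
    have hbinv : b⁻¹ = b := inv_eq_of_mul_eq_one_left (by rw [← pow_two, hb])
    have h1 : a * b = (a * b)⁻¹ := eq_inv_of_mul_eq_one_left (by rw [← pow_two, hab])
    rw [mul_inv_rev, hbinv] at h1
    exact h1.symm
  have h2 := (h.zpow_right j).eq
  rw [inv_zpow'] at h2
  exact h2.symm

/-- The homomorphism `Dₙ → Q` with `σ ↦ a` and `τ ↦ b`, if `a` and `b` satisfy the defining
relations of `Dₙ`. -/
def dihedralLift {Q : Type*} [Group Q] (n : ℕ) (a b : Q) (ha : a ^ n = 1) (hb : b ^ 2 = 1)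
    (hab : (a * b) ^ 2 = 1) : DihedralGroup n →* Q :=
  let p : ZMod n →+ Additive Q := ZMod.lift n ⟨zmultiplesHom (Additive Q) (Additive.ofMul a), by
    rw [zmultiplesHom_apply, natCast_zsmul, ← ofMul_pow, ha, ofMul_one]⟩
  have hadd : ∀ i j, (p (i + j)).toMul = (p i).toMul * (p j).toMul := fun i j => by
    rw [map_add, toMul_add]
  have hbb : b * b = 1 := by rw [← pow_two, hb]
  have hconj : ∀ i : ZMod n, (p i).toMul * b = b * (p (-i)).toMul := fun i => by
    obtain ⟨j, rfl⟩ := ZMod.intCast_surjective i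
    have hj : ∀ j : ℤ, (p (j : ZMod n)).toMul = a ^ j := fun j => by simp [p]
    rw [← Int.cast_neg, hj, hj, zpow_mul_eq_mul_zpow_neg hb hab]
  { toFun := fun g => match g with
      | .r i => (p i).toMul
      | .sr i => b * (p i).toMul
    map_one' := by
      change (p 0).toMul = 1
      rw [map_zero, toMul_zero]
    map_mul' := by
      rintro (i | i) (j | j)
      · exact hadd i j
      · change b * (p (j - i)).toMul = (p i).toMul * (b * (p j).toMul)
        rw [← mul_assoc, hconj, sub_eq_neg_add, hadd, mul_assoc]
      · change b * (p (i + j)).toMul = b * (p i).toMul * (p j).toMul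
        rw [hadd, mul_assoc]
      · change (p (j - i)).toMul = b * (p i).toMul * (b * (p j).toMul)
        rw [mul_assoc, ← mul_assoc _ b, hconj, ← mul_assoc, ← mul_assoc, hbb, one_mul,
          sub_eq_neg_add, hadd] }

theorem dihedralLift_r_one {Q : Type*} [Group Q] (n : ℕ) (a b : Q) (ha : a ^ n = 1)
    (hb : b ^ 2 = 1) (hab : (a * b) ^ 2 = 1) :
    dihedralLift n a b ha hb hab (DihedralGroup.r 1) = a := by
  have h : ZMod.lift n ⟨zmultiplesHom (Additive Q) (Additive.ofMul a), by
    rw [zmultiplesHom_apply, natCast_zsmul, ← ofMul_pow, ha, ofMul_one]⟩ (1 : ZMod n) =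
      Additive.ofMul a := by
    rw [← Int.cast_one, ZMod.lift_coe]
    simp
  exact congrArg Additive.toMul h

theorem dihedralLift_sr_zero {Q : Type*} [Group Q] (n : ℕ) (a b : Q) (ha : a ^ n = 1)
    (hb : b ^ 2 = 1) (hab : (a * b) ^ 2 = 1) :
    dihedralLift n a b ha hb hab (DihedralGroup.sr 0) = b := by
  have h : ZMod.lift n ⟨zmultiplesHom (Additive Q) (Additive.ofMul a), by
    rw [zmultiplesHom_apply, natCast_zsmul, ← ofMul_pow, ha, ofMul_one]⟩ (0 : ZMod n) = 0 :=
    map_zero _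
  exact mul_eq_left.mpr (congrArg Additive.toMul h)

variable (n : ℕ)

theorem dihedralPresentation_of_zero :
    dihedralPresentation n (FreeGroup.of 0) = DihedralGroup.r 1 := by
  simp [dihedralPresentation]

theorem dihedralPresentation_of_one :
    dihedralPresentation n (FreeGroup.of 1) = DihedralGroup.sr 0 := by
  simp [dihedralPresentation]

/-- The relator `s₁ⁿ`. -/
def rotationRelator : (dihedralPresentation n).ker :=
  ⟨FreeGroup.of 0 ^ n, by
    rw [MonoidHom.mem_ker, map_pow, dihedralPresentation_of_zero, DihedralGroup.r_one_pow_n]⟩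

/-- The relator `s₂²`. -/
def reflectionRelator : (dihedralPresentation n).ker :=
  ⟨FreeGroup.of 1 ^ 2, by
    rw [MonoidHom.mem_ker, map_pow, dihedralPresentation_of_one, pow_two,
      DihedralGroup.sr_mul_self]⟩

/-- The relator `(s₁ s₂)²`. -/
def productRelator : (dihedralPresentation n).ker :=
  ⟨(FreeGroup.of 0 * FreeGroup.of 1) ^ 2, by
    rw [MonoidHom.mem_ker, map_pow, map_mul, dihedralPresentation_of_one,
      dihedralPresentation_of_zero, DihedralGroup.r_mul_sr, pow_two, DihedralGroup.sr_mul_self]⟩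

theorem coe_rotationRelator : (rotationRelator n : FreeGroup (Fin 2)) = FreeGroup.of 0 ^ n := rfl

theorem coe_reflectionRelator :
    (reflectionRelator n : FreeGroup (Fin 2)) = FreeGroup.of 1 ^ 2 := rfl

theorem coe_productRelator :
    (productRelator n : FreeGroup (Fin 2)) = (FreeGroup.of 0 * FreeGroup.of 1) ^ 2 := rfl

/-- The class of `s₁ⁿ`, with stabilizer `⟨σ⟩`. -/
def rotationClass : RelationModule (dihedralPresentation n) := relClass _ (rotationRelator n)

/-- The other conjugate of the class of `s₁ⁿ`. -/
def rotationClass' : RelationModule (dihedralPresentation n) :=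
  dihedralRelationRep n (DihedralGroup.sr 0) (rotationClass n)

/-- The conjugates `σᶜ • [s₂²]`. -/
def reflectionClass (c : ZMod n) : RelationModule (dihedralPresentation n) :=
  dihedralRelationRep n (DihedralGroup.r c) (relClass _ (reflectionRelator n))

/-- The conjugates `σᶜ • [(s₁ s₂)²]`. -/
def productClass (c : ZMod n) : RelationModule (dihedralPresentation n) :=
  dihedralRelationRep n (DihedralGroup.r c) (relClass _ (productRelator n))

theorem dihedralRelationRep_mul (g h : DihedralGroup n)
    (m : RelationModule (dihedralPresentation n)) :
    dihedralRelationRep n g (dihedralRelationRep n h m) = dihedralRelationRep n (g * h) m := by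
  rw [map_mul]; rfl

theorem dihedralRelationRep_r_rotationClass (i : ZMod n) :
    dihedralRelationRep n (DihedralGroup.r i) (rotationClass n) = rotationClass n := by
  obtain ⟨j, rfl⟩ := ZMod.intCast_surjective i
  have h := relationModuleRep_relClass (dihedralPresentation n) (dihedralPresentation_surjective n)
    (FreeGroup.of 0 ^ j) (rotationRelator n) (rotationRelator n) (by
      rw [coe_rotationRelator, eq_mul_inv_iff_mul_eq]
      exact ((Commute.refl _).pow_left n).zpow_right j)
  rwa [map_zpow, dihedralPresentation_of_zero, DihedralGroup.r_one_zpow] at h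

theorem dihedralRelationRep_sr_rotationClass (i : ZMod n) :
    dihedralRelationRep n (DihedralGroup.sr i) (rotationClass n) = rotationClass' n := by
  rw [← zero_add i, ← DihedralGroup.sr_mul_r, ← dihedralRelationRep_mul,
    dihedralRelationRep_r_rotationClass]
  rfl

theorem dihedralRelationRep_r_rotationClass' (i : ZMod n) :
    dihedralRelationRep n (DihedralGroup.r i) (rotationClass' n) = rotationClass' n := by
  rw [rotationClass', dihedralRelationRep_mul, DihedralGroup.r_mul_sr,
    dihedralRelationRep_sr_rotationClass]
  rfl

theorem dihedralRelationRep_sr_rotationClass' (i : ZMod n) :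
    dihedralRelationRep n (DihedralGroup.sr i) (rotationClass' n) = rotationClass n := by
  rw [rotationClass', dihedralRelationRep_mul, DihedralGroup.sr_mul_sr,
    dihedralRelationRep_r_rotationClass]

theorem dihedralRelationRep_r_reflectionClass (i c : ZMod n) :
    dihedralRelationRep n (DihedralGroup.r i) (reflectionClass n c) =
      reflectionClass n (i + c) := by
  rw [reflectionClass, dihedralRelationRep_mul, DihedralGroup.r_mul_r]
  rfl

theorem dihedralRelationRep_sr_reflectionClass (i c : ZMod n) :
    dihedralRelationRep n (DihedralGroup.sr i) (reflectionClass n c) =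
      reflectionClass n (-(i + c)) := by
  have h0 : dihedralRelationRep n (DihedralGroup.sr 0) (relClass _ (reflectionRelator n)) =
      relClass _ (reflectionRelator n) := by
    have h := relationModuleRep_relClass (dihedralPresentation n)
      (dihedralPresentation_surjective n) (FreeGroup.of 1) (reflectionRelator n)
      (reflectionRelator n) (by rw [coe_reflectionRelator, pow_two, mul_assoc, mul_inv_cancel_right])
    rwa [dihedralPresentation_of_one] at h
  have h1 : DihedralGroup.sr (i + c) = DihedralGroup.r (-(i + c)) * DihedralGroup.sr 0 := by
    simp
  rw [reflectionClass, dihedralRelationRep_mul, DihedralGroup.sr_mul_r, h1,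
    ← dihedralRelationRep_mul, h0]
  rfl

theorem dihedralRelationRep_r_productClass (i c : ZMod n) :
    dihedralRelationRep n (DihedralGroup.r i) (productClass n c) = productClass n (i + c) := by
  rw [productClass, dihedralRelationRep_mul, DihedralGroup.r_mul_r]
  rfl

theorem dihedralRelationRep_sr_productClass (i c : ZMod n) :
    dihedralRelationRep n (DihedralGroup.sr i) (productClass n c) =
      productClass n (-1 - (i + c)) := by
  have h0 : dihedralRelationRep n (DihedralGroup.sr (-1)) (relClass _ (productRelator n)) =
      relClass _ (productRelator n) := by
    have h := relationModuleRep_relClass (dihedralPresentation n)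
      (dihedralPresentation_surjective n) (FreeGroup.of 0 * FreeGroup.of 1) (productRelator n)
      (productRelator n) (by
        rw [coe_productRelator, eq_mul_inv_iff_mul_eq]
        exact ((Commute.refl _).pow_left 2).eq)
    rwa [map_mul, dihedralPresentation_of_one, dihedralPresentation_of_zero,
      DihedralGroup.r_mul_sr, zero_sub] at h
  have h1 : DihedralGroup.sr (i + c) =
      DihedralGroup.r (-1 - (i + c)) * DihedralGroup.sr (-1) := by
    simp
  rw [productClass, dihedralRelationRep_mul, DihedralGroup.sr_mul_r, h1,
    ← dihedralRelationRep_mul, h0]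
  rfl

/-- The identity among the relators: the faces of the spherical Cayley complex of the presentation
add up to zero. It comes from `s₂ s₁ s₂⁻¹ = s₁⁻¹ e` with `e = (s₁ s₂)² (s₂²)⁻¹`, by expanding
`s₂ s₁ⁿ s₂⁻¹ = (s₁⁻¹ e)ⁿ`. -/
theorem rotationClass_add_rotationClass' [NeZero n] :
    rotationClass n + rotationClass' n + ∑ c, reflectionClass n c = ∑ c, productClass n c := by
  set ε := dihedralPresentation n with hε
  have hker : ∀ (e : ε.ker) (m : ℕ), ∃ r : ε.ker,
      (r : FreeGroup (Fin 2)) =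
        ((FreeGroup.of 0)⁻¹ * (e : FreeGroup (Fin 2))) ^ m * FreeGroup.of 0 ^ m ∧
      relClass ε r = ∑ i ∈ Finset.range m,
        dihedralRelationRep n (DihedralGroup.r (-((i + 1 : ℕ) : ZMod n))) (relClass ε e) := by
    intro e m
    induction m with
    | zero => exact ⟨1, by simp, by simp [relClass_one]⟩
    | succ m ih =>
      obtain ⟨r, hr, hcls⟩ := ih
      refine ⟨⟨(FreeGroup.of 0)⁻¹ * ((e * r : ε.ker) : FreeGroup (Fin 2)) *
        ((FreeGroup.of 0)⁻¹)⁻¹, ε.normal_ker.conj_mem _ (e * r).2 _⟩, ?_, ?_⟩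
      · change (FreeGroup.of 0)⁻¹ * ((e : FreeGroup (Fin 2)) * (r : FreeGroup (Fin 2))) *
          ((FreeGroup.of 0)⁻¹)⁻¹ = _
        rw [hr, pow_succ' (_ * _), pow_succ (FreeGroup.of 0)]
        simp only [mul_assoc, inv_inv]
      · have h := relationModuleRep_relClass ε (dihedralPresentation_surjective n)
          (FreeGroup.of 0)⁻¹ (e * r) ⟨(FreeGroup.of 0)⁻¹ * ((e * r : ε.ker) :
            FreeGroup (Fin 2)) * ((FreeGroup.of 0)⁻¹)⁻¹, ε.normal_ker.conj_mem _ (e * r).2 _⟩ rfl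
        rw [← h, map_inv, dihedralPresentation_of_zero, DihedralGroup.inv_r, relClass_mul, map_add,
          hcls, map_sum, Finset.sum_range_succ', add_comm]
        congr 1
        · refine Finset.sum_congr rfl fun i _ => ?_
          change dihedralRelationRep n _ (dihedralRelationRep n _ _) = _
          rw [dihedralRelationRep_mul, DihedralGroup.r_mul_r]
          congr 3
          push_cast
          ring
        · rw [zero_add, Nat.cast_one]
          rfl
  obtain ⟨r, hr, hcls⟩ := hker (productRelator n * (reflectionRelator n)⁻¹) n
  have h1 : rotationClass' n = relClass ε (r * (rotationRelator n)⁻¹) := by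
    have h := relationModuleRep_relClass ε (dihedralPresentation_surjective n)
      (FreeGroup.of 1) (rotationRelator n) (r * (rotationRelator n)⁻¹) (by
        rw [Subgroup.coe_mul, hr, Subgroup.coe_inv, coe_rotationRelator, mul_inv_cancel_right,
          Subgroup.coe_mul, Subgroup.coe_inv, coe_productRelator, coe_reflectionRelator,
          ← conj_pow]
        congr 1
        simp only [pow_two]
        group)
    rw [dihedralPresentation_of_one] at h
    exact h
  rw [h1, relClass_mul, relClass_inv, hcls, rotationClass, relClass_mul, relClass_inv]
  have h2 : ∀ v : RelationModule (dihedralPresentation n), ∑ i ∈ Finset.range n,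
      dihedralRelationRep n (DihedralGroup.r (-((i + 1 : ℕ) : ZMod n))) v =
        ∑ c : ZMod n, dihedralRelationRep n (DihedralGroup.r c) v := by
    intro v
    refine Finset.sum_bij (fun i _ => -((i + 1 : ℕ) : ZMod n)) (fun _ _ => Finset.mem_univ _)
      ?_ ?_ fun _ _ => rfl
    · intro i hi j hj hij
      have h3 : ((i : ℕ) : ZMod n) = j := by
        have := neg_injective hij
        push_cast at this
        exact add_right_cancel this
      rw [ZMod.natCast_eq_natCast_iff'] at h3
      rwa [Nat.mod_eq_of_lt (Finset.mem_range.mp hi),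
        Nat.mod_eq_of_lt (Finset.mem_range.mp hj)] at h3
    · intro c _
      refine ⟨(-c - 1).val, Finset.mem_range.mpr (ZMod.val_lt _), ?_⟩
      push_cast
      rw [ZMod.natCast_zmod_val]
      ring
  rw [h2]
  simp only [map_add, map_neg, Finset.sum_add_distrib, Finset.sum_neg_distrib]
  unfold reflectionClass productClass
  abel

/-- The family `[s₁ⁿ]`, `σᶜ • [s₂²]`, `σᶜ • [(s₁ s₂)²]` of `2n + 1` elements of `R^ab`. -/
def relationBasis : Unit ⊕ (ZMod n ⊕ ZMod n) → RelationModule (dihedralPresentation n) :=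
  Sum.elim (fun _ => rotationClass n) (Sum.elim (reflectionClass n) (productClass n))

theorem rotationClass'_mem_span [NeZero n] :
    rotationClass' n ∈ Submodule.span ℤ (Set.range (relationBasis n)) := by
  have h : rotationClass' n =
      ∑ c, productClass n c - ∑ c, reflectionClass n c - rotationClass n := by
    rw [← rotationClass_add_rotationClass']
    abel
  rw [h]
  refine sub_mem (sub_mem (sum_mem fun c _ => ?_) (sum_mem fun c _ => ?_)) ?_
  · exact Submodule.subset_span ⟨Sum.inr (Sum.inr c), rfl⟩
  · exact Submodule.subset_span ⟨Sum.inr (Sum.inl c), rfl⟩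
  · exact Submodule.subset_span ⟨Sum.inl (), rfl⟩

theorem dihedralRelationRep_mem_span [NeZero n] (g : DihedralGroup n)
    {m : RelationModule (dihedralPresentation n)}
    (hm : m ∈ Submodule.span ℤ (Set.range (relationBasis n))) :
    dihedralRelationRep n g m ∈ Submodule.span ℤ (Set.range (relationBasis n)) := by
  induction hm using Submodule.span_induction with
  | mem x hx =>
    obtain ⟨i, rfl⟩ := hx
    rcases g with j | j <;> rcases i with _ | c | c
    · change dihedralRelationRep n _ (rotationClass n) ∈ _
      rw [dihedralRelationRep_r_rotationClass]
      exact Submodule.subset_span ⟨Sum.inl (), rfl⟩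
    · change dihedralRelationRep n _ (reflectionClass n c) ∈ _
      rw [dihedralRelationRep_r_reflectionClass]
      exact Submodule.subset_span ⟨Sum.inr (Sum.inl _), rfl⟩
    · change dihedralRelationRep n _ (productClass n c) ∈ _
      rw [dihedralRelationRep_r_productClass]
      exact Submodule.subset_span ⟨Sum.inr (Sum.inr _), rfl⟩
    · change dihedralRelationRep n _ (rotationClass n) ∈ _
      rw [dihedralRelationRep_sr_rotationClass]
      exact rotationClass'_mem_span n
    · change dihedralRelationRep n _ (reflectionClass n c) ∈ _
      rw [dihedralRelationRep_sr_reflectionClass]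
      exact Submodule.subset_span ⟨Sum.inr (Sum.inl _), rfl⟩
    · change dihedralRelationRep n _ (productClass n c) ∈ _
      rw [dihedralRelationRep_sr_productClass]
      exact Submodule.subset_span ⟨Sum.inr (Sum.inr _), rfl⟩
  | zero => rw [map_zero]; exact zero_mem _
  | add x y _ _ hx hy => rw [map_add]; exact add_mem hx hy
  | smul a x _ hx => rw [map_smul]; exact Submodule.smul_mem _ a hx

/-- The relators whose class lies in the span of `relationBasis` form a normal subgroup of the free
group that contains the defining relators of `Dₙ`, hence all of `R`. -/
theorem span_relationBasis [NeZero n] :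
    Submodule.span ℤ (Set.range (relationBasis n)) = ⊤ := by
  set P := Submodule.span ℤ (Set.range (relationBasis n)) with hP
  let N : Subgroup (FreeGroup (Fin 2)) :=
    { carrier := {x | ∃ r : (dihedralPresentation n).ker, (r : FreeGroup (Fin 2)) = x ∧
        relClass _ r ∈ P}
      one_mem' := ⟨1, rfl, by rw [relClass_one]; exact zero_mem P⟩
      mul_mem' := by
        rintro _ _ ⟨r, rfl, hr⟩ ⟨r', rfl, hr'⟩
        exact ⟨r * r', rfl, by rw [relClass_mul]; exact add_mem hr hr'⟩
      inv_mem' := by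
        rintro _ ⟨r, rfl, hr⟩
        exact ⟨r⁻¹, rfl, by rw [relClass_inv]; exact neg_mem hr⟩ }
  have hN : N.Normal := by
    constructor
    rintro _ ⟨r, rfl, hr⟩ x
    refine ⟨⟨x * r * x⁻¹, (dihedralPresentation n).normal_ker.conj_mem _ r.2 x⟩, rfl, ?_⟩
    rw [← relationModuleRep_relClass _ (dihedralPresentation_surjective n) x r _ rfl]
    exact dihedralRelationRep_mem_span n _ hr
  have h1 : ∀ v, dihedralRelationRep n (DihedralGroup.r 0) v = v := fun v => by
    rw [DihedralGroup.r_zero, map_one]; rfl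
  have ha : (QuotientGroup.mk' N (FreeGroup.of 0)) ^ n = 1 := by
    rw [← map_pow]
    exact (QuotientGroup.eq_one_iff _).mpr
      ⟨rotationRelator n, rfl, Submodule.subset_span ⟨Sum.inl (), rfl⟩⟩
  have hb : (QuotientGroup.mk' N (FreeGroup.of 1)) ^ 2 = 1 := by
    rw [← map_pow]
    exact (QuotientGroup.eq_one_iff _).mpr
      ⟨reflectionRelator n, rfl, Submodule.subset_span ⟨Sum.inr (Sum.inl 0), h1 _⟩⟩
  have hab : (QuotientGroup.mk' N (FreeGroup.of 0) * QuotientGroup.mk' N (FreeGroup.of 1)) ^ 2 =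
      1 := by
    rw [← map_mul, ← map_pow]
    exact (QuotientGroup.eq_one_iff _).mpr
      ⟨productRelator n, rfl, Submodule.subset_span ⟨Sum.inr (Sum.inr 0), h1 _⟩⟩
  have hlift : (dihedralLift n _ _ ha hb hab).comp (dihedralPresentation n) =
      QuotientGroup.mk' N := by
    ext i
    fin_cases i
    · change dihedralLift n _ _ ha hb hab (dihedralPresentation n (FreeGroup.of 0)) = _
      rw [dihedralPresentation_of_zero, dihedralLift_r_one]
      rfl
    · change dihedralLift n _ _ ha hb hab (dihedralPresentation n (FreeGroup.of 1)) = _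
      rw [dihedralPresentation_of_one, dihedralLift_sr_zero]
      rfl
  rw [eq_top_iff]
  intro m _
  obtain ⟨r, rfl⟩ := relClass_surjective _ m
  have hr : QuotientGroup.mk' N (r : FreeGroup (Fin 2)) = 1 := by
    rw [← hlift, MonoidHom.comp_apply, MonoidHom.mem_ker.mp r.2, map_one]
  obtain ⟨r', hr', hmem⟩ := (QuotientGroup.eq_one_iff _).mp hr
  rwa [← Subtype.ext hr']

/-- The counts of traversed edges separate the elements of `relationBasis`. -/
theorem linearIndependent_relationBasis [NeZero n] :
    LinearIndependent ℤ (relationBasis n) := by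
  -- `E₀` and `E₁` count the `s₁`-edges and the `s₂`-edges.
  set E₀ : DihedralGroup n → RelationModule (dihedralPresentation n) →+ ℤ :=
    relationModuleCount (dihedralPresentation n) ![1, 0] with hE₀
  set E₁ : DihedralGroup n → RelationModule (dihedralPresentation n) →+ ℤ :=
    relationModuleCount (dihedralPresentation n) ![0, 1] with hE₁
  have hrep₀ : ∀ g h m, E₀ h (dihedralRelationRep n g m) = E₀ (g⁻¹ * h) m :=
    fun g h m => relationModuleCount_rep _ (dihedralPresentation_surjective n) _ g h m
  have hrep₁ : ∀ g h m, E₁ h (dihedralRelationRep n g m) = E₁ (g⁻¹ * h) m :=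
    fun g h m => relationModuleCount_rep _ (dihedralPresentation_surjective n) _ g h m
  -- The path of `s₁ᵐ` from `1` stays among the rotations.
  have hpow : ∀ m : ℕ, (∀ j : ZMod n, ((cayleyCount (dihedralPresentation n) ![1, 0]
        (FreeGroup.of 0 ^ m)).left (DihedralGroup.sr j)).toAdd = 0) ∧
      (∀ h, 0 ≤ ((cayleyCount (dihedralPresentation n) ![1, 0]
        (FreeGroup.of 0 ^ m)).left h).toAdd) := by
    intro m
    induction m with
    | zero => constructor <;> intros <;> simp
    | succ m ih =>
      constructor
      · intro j
        rw [pow_succ', cayleyCount_mul_left, cayleyCount_of_left, dihedralPresentation_of_zero,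
          DihedralGroup.inv_r, DihedralGroup.r_mul_sr, ih.1]
        simp [DihedralGroup.one_def, -DihedralGroup.r_zero]
      · intro h
        rw [pow_succ', cayleyCount_mul_left, cayleyCount_of_left]
        refine add_nonneg ?_ (ih.2 _)
        split_ifs <;> simp
  have hrot_sr : ∀ j, E₀ (DihedralGroup.sr j) (rotationClass n) = 0 := fun j => (hpow n).1 j
  have hrot_one : E₀ 1 (rotationClass n) ≠ 0 := by
    obtain ⟨m, hm⟩ := Nat.exists_eq_succ_of_ne_zero (NeZero.ne n)
    change ((cayleyCount (dihedralPresentation n) ![1, 0] (FreeGroup.of 0 ^ n)).left 1).toAdd ≠ 0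
    conv in FreeGroup.of 0 ^ n => rw [hm]
    rw [pow_succ', cayleyCount_mul_left, cayleyCount_of_left, if_pos rfl]
    have := (hpow m).2 ((dihedralPresentation n (FreeGroup.of 0))⁻¹ * 1)
    have h1 : (![1, 0] : Fin 2 → ℤ) 0 = 1 := rfl
    rw [h1]
    omega
  have href₀ : ∀ h, E₀ h (relClass (dihedralPresentation n) (reflectionRelator n)) = 0 := by
    intro h
    rw [hE₀, relationModuleCount_relClass, coe_reflectionRelator, pow_two, cayleyCount_mul_left,
      cayleyCount_of_left, cayleyCount_of_left]
    simp
  have href₁ : ∀ j, E₁ (DihedralGroup.r j)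
      (relClass (dihedralPresentation n) (reflectionRelator n)) =
      if j = 0 then 1 else 0 := by
    intro h
    rw [hE₁, relationModuleCount_relClass, coe_reflectionRelator, pow_two, cayleyCount_mul_left,
      cayleyCount_of_left, cayleyCount_of_left, dihedralPresentation_of_one,
      DihedralGroup.inv_sr, DihedralGroup.sr_mul_r]
    simp [DihedralGroup.one_def, -DihedralGroup.r_zero]
  have hprod : ∀ j, E₀ (DihedralGroup.sr j)
      (relClass (dihedralPresentation n) (productRelator n)) =
      if j = -1 then 1 else 0 := by
    intro j
    rw [hE₀, relationModuleCount_relClass, coe_productRelator, pow_two, mul_assoc,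
      cayleyCount_mul_left, cayleyCount_mul_left, cayleyCount_mul_left, cayleyCount_of_left,
      cayleyCount_of_left, cayleyCount_of_left, cayleyCount_of_left, dihedralPresentation_of_one,
      dihedralPresentation_of_zero, DihedralGroup.inv_sr, DihedralGroup.inv_r,
      DihedralGroup.r_mul_sr, DihedralGroup.sr_mul_sr, DihedralGroup.r_mul_r]
    simp [DihedralGroup.one_def, -DihedralGroup.r_zero, add_eq_zero_iff_eq_neg]
  have hr0 : ∀ c : ZMod n, (DihedralGroup.r c)⁻¹ = DihedralGroup.r (-c) := fun c =>
    DihedralGroup.inv_r c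
  rw [Fintype.linearIndependent_iff]
  intro f hf
  simp only [Fintype.sum_sum_type, Finset.univ_unique, Finset.sum_singleton, relationBasis,
    Sum.elim_inl, Sum.elim_inr] at hf
  have hf₀ : ∀ h, f (Sum.inl ()) * E₀ h (rotationClass n) +
      ∑ c, f (Sum.inr (Sum.inr c)) *
        E₀ (DihedralGroup.r (-c) * h)
          (relClass (dihedralPresentation n) (productRelator n)) = 0 := by
    intro h
    have h1 := congrArg (E₀ h) hf
    simpa [reflectionClass, productClass, hrep₀, href₀, hr0] using h1
  -- The count of `s₁`-edges at reflections involves only the classes of the `(s₁ s₂)²`.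
  have hδ : ∀ c, f (Sum.inr (Sum.inr c)) = 0 := by
    intro c
    have h1 := hf₀ (DihedralGroup.sr (-1 - c))
    rw [hrot_sr, mul_zero, zero_add, Finset.sum_eq_single c] at h1
    · rw [DihedralGroup.r_mul_sr, hprod, if_pos (by ring), mul_one] at h1
      exact h1
    · intro c' _ hc'
      rw [DihedralGroup.r_mul_sr, hprod, if_neg, mul_zero]
      intro h2
      exact hc' (by linear_combination h2)
    · simp
  have hα : f (Sum.inl ()) = 0 := by
    have h1 := hf₀ 1
    simp only [hδ, zero_mul, Finset.sum_const_zero, add_zero] at h1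
    exact (mul_eq_zero.mp h1).resolve_right hrot_one
  have hβ : ∀ c, f (Sum.inr (Sum.inl c)) = 0 := by
    intro c
    have h1 := congrArg (E₁ (DihedralGroup.r c)) hf
    simp only [PUnit.default_eq_unit, hα, hδ, zero_smul, Finset.sum_const_zero, add_zero,
      zero_add, map_sum, map_zsmul, reflectionClass, hrep₁, hr0, DihedralGroup.r_mul_r, href₁,
      map_zero] at h1
    rw [Finset.sum_eq_single c] at h1
    · simpa using h1
    · intro c' _ hc'
      rw [if_neg, smul_zero]
      intro h2
      exact hc' (by linear_combination -h2)
    · simp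
  rintro (_ | c | c)
  exacts [hα, hβ c, hδ c]

end Dihedral

/-! ### Generators of the fields `K(M)` -/

section LatticeField

variable {k K M G : Type*} [Field k] [Field K] [Algebra k K] [AddCommGroup M]
  [Group G]

/-- The element of `K(M)` given by an element of the lattice `M`. -/
def latticeMonomial (K : Type*) [Field K] (m : M) : LatticeField K M :=
  algebraMap (AddMonoidAlgebra K M) (LatticeField K M) (AddMonoidAlgebra.single m 1)

theorem latticeMonomial_add (m m' : M) :
    latticeMonomial K (m + m') = latticeMonomial K m * latticeMonomial K m' := by
  rw [latticeMonomial, latticeMonomial, latticeMonomial, ← map_mul,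
    AddMonoidAlgebra.single_mul_single, one_mul]

theorem latticeMonomial_zero : latticeMonomial K (0 : M) = 1 := by
  rw [latticeMonomial, ← AddMonoidAlgebra.one_def, map_one]

theorem latticeMonomial_ne_zero (m : M) : latticeMonomial K m ≠ 0 := by
  intro h
  have h1 := latticeMonomial_add (K := K) m (-m)
  rw [h, zero_mul, add_neg_cancel, latticeMonomial_zero] at h1
  exact one_ne_zero h1

variable [Module.Free ℤ M]

theorem latticeMonomial_neg (m : M) : latticeMonomial K (-m) = (latticeMonomial K m)⁻¹ := by
  refine eq_inv_of_mul_eq_one_left ?_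
  rw [← latticeMonomial_add, neg_add_cancel, latticeMonomial_zero]

omit [Module.Free ℤ M] in
theorem latticeMonomial_sum {ι : Type*} (s : Finset ι) (f : ι → M) :
    latticeMonomial K (∑ i ∈ s, f i) = ∏ i ∈ s, latticeMonomial K (f i) := by
  classical
  induction s using Finset.induction_on with
  | empty => exact latticeMonomial_zero
  | insert a s ha ih => rw [Finset.sum_insert ha, Finset.prod_insert ha, latticeMonomial_add, ih]

theorem latticeFieldAction_monomial (ρ : G →* Gal(K/k)) (π : Representation ℤ G M) (g : G)
    (m : M) :
    latticeFieldAction ρ π g (latticeMonomial K m) = latticeMonomial K (π g m) := by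
  rw [latticeMonomial, latticeFieldAction_single, map_one]
  rfl

omit [Module.Free ℤ M] in
theorem latticeField_algebraMap_apply (a : K) :
    algebraMap K (LatticeField K M) a =
      algebraMap (AddMonoidAlgebra K M) (LatticeField K M) (AddMonoidAlgebra.single 0 a) :=
  IsScalarTower.algebraMap_apply K (AddMonoidAlgebra K M) (LatticeField K M) a

theorem latticeFieldAction_algebraMap (ρ : G →* Gal(K/k)) (π : Representation ℤ G M) (g : G)
    (a : K) :
    latticeFieldAction ρ π g (algebraMap K (LatticeField K M) a) =
      algebraMap K (LatticeField K M) (ρ g a) := by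
  rw [latticeField_algebraMap_apply, latticeFieldAction_single, map_zero,
    latticeField_algebraMap_apply]

/-- A basis of the lattice `M` gives independent generators of the field `K(M)`. -/
theorem isRationalBasis_latticeMonomial {ι : Type*} {v : ι → M} (hv : LinearIndependent ℤ v)
    (hspan : Submodule.span ℤ (Set.range v) = ⊤) :
    IsRationalBasis K fun i => latticeMonomial K (v i) := by
  constructor
  · let φ : (ι →₀ ℕ) →+ M := Finsupp.liftAddHom fun i => (multiplesHom M (v i))
    have hφ : Injective φ := by
      intro s t hst
      have h : ∀ s : ι →₀ ℕ, φ s = Finsupp.linearCombination ℤ v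
          (s.mapRange (Nat.cast : ℕ → ℤ) Nat.cast_zero) := by
        intro s
        rw [Finsupp.linearCombination_apply, Finsupp.sum_mapRange_index (by simp)]
        simp [φ, Finsupp.sum]
      rw [h, h] at hst
      exact Finsupp.mapRange_injective _ Nat.cast_zero Nat.cast_injective (hv hst)
    let f : MvPolynomial ι K →ₐ[K] AddMonoidAlgebra K M := AddMonoidAlgebra.mapDomainAlgHom K K φ
    have hf : Injective f := AddMonoidAlgebra.mapDomain_injective hφ
    have hX : ∀ i, f (MvPolynomial.X i) = AddMonoidAlgebra.single (v i) 1 := by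
      intro i
      change AddMonoidAlgebra.mapDomain φ (AddMonoidAlgebra.single (Finsupp.single i 1) 1) = _
      rw [AddMonoidAlgebra.mapDomain_single]
      simp [φ]
    rw [algebraicIndependent_iff_injective_aeval]
    have h : (MvPolynomial.aeval fun i => latticeMonomial K (v i)) =
        ((Algebra.ofId (AddMonoidAlgebra K M) (LatticeField K M)).restrictScalars K).comp f := by
      apply MvPolynomial.algHom_ext
      intro i
      rw [MvPolynomial.aeval_X, AlgHom.comp_apply, hX]
      rfl
    rw [h, AlgHom.coe_comp]
    exact (IsFractionRing.injective (AddMonoidAlgebra K M) (LatticeField K M)).comp hf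
  · set T := IntermediateField.adjoin K (Set.range fun i => latticeMonomial K (v i)) with hT
    have hm : ∀ m : M, latticeMonomial K m ∈ T := by
      intro m
      have hm : m ∈ Submodule.span ℤ (Set.range v) := hspan ▸ Submodule.mem_top
      rw [← Submodule.mem_toAddSubgroup, Submodule.span_int_eq_addSubgroupClosure] at hm
      induction hm using AddSubgroup.closure_induction with
      | mem x hx =>
        obtain ⟨i, rfl⟩ := hx
        exact IntermediateField.subset_adjoin _ _ ⟨i, rfl⟩
      | zero => rw [latticeMonomial_zero]; exact one_mem T
      | add x y _ _ hx hy => rw [latticeMonomial_add]; exact mul_mem hx hy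
      | neg x _ hx => rw [latticeMonomial_neg]; exact inv_mem hx
    have hring : ∀ p : AddMonoidAlgebra K M,
        algebraMap (AddMonoidAlgebra K M) (LatticeField K M) p ∈ T := by
      intro p
      induction p using AddMonoidAlgebra.induction_linear with
      | zero => rw [map_zero]; exact zero_mem T
      | add x y hx hy => rw [map_add]; exact add_mem hx hy
      | single m a =>
        have h : AddMonoidAlgebra.single m a =
            AddMonoidAlgebra.single 0 a * AddMonoidAlgebra.single m (1 : K) := by
          rw [AddMonoidAlgebra.single_mul_single, zero_add, mul_one]
        rw [h, map_mul, ← latticeField_algebraMap_apply]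
        exact mul_mem (T.algebraMap_mem a) (hm m)
    rw [← top_le_iff]
    intro x _
    obtain ⟨p, q, _, rfl⟩ := IsFractionRing.div_surjective (A := AddMonoidAlgebra K M) x
    exact div_mem (hring p) (hring q)

end LatticeField

/-! ### Restricting an action to a stable subfield -/

section Restrict

variable {k k' Ω G : Type*} [Field k] [Field k'] [Field Ω] [Algebra k k'] [Algebra k Ω]
  [Algebra k' Ω] [IsScalarTower k k' Ω] [Group G]

/-- The restriction of an action on `Ω` to a stable subfield. -/
def restrictAction (a : G →* Gal(Ω/k)) (L : IntermediateField k' Ω)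
    (hL : ∀ g, ∀ x ∈ L, a g x ∈ L) : G →* Gal(L/k) where
  toFun g :=
    { toFun := fun x => ⟨a g x, hL g x x.2⟩
      invFun := fun x => ⟨a g⁻¹ x, hL g⁻¹ x x.2⟩
      left_inv := fun x => Subtype.ext (by
        change (a g⁻¹ * a g) (x : Ω) = x
        rw [← map_mul, inv_mul_cancel, map_one]; rfl)
      right_inv := fun x => Subtype.ext (by
        change (a g * a g⁻¹) (x : Ω) = x
        rw [← map_mul, mul_inv_cancel, map_one]; rfl)
      map_mul' := fun x y => Subtype.ext (map_mul (a g) (x : Ω) y)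
      map_add' := fun x y => Subtype.ext (map_add (a g) (x : Ω) y)
      commutes' := fun c => Subtype.ext ((a g).commutes c) }
  map_one' := by ext x; simp
  map_mul' g h := by ext x; simp

theorem coe_restrictAction (a : G →* Gal(Ω/k)) (L : IntermediateField k' Ω)
    (hL : ∀ g, ∀ x ∈ L, a g x ∈ L) (g : G) (x : L) :
    (restrictAction a L hL g x : Ω) = a g x := rfl

theorem fixedField_equiv_congr {E E' : Type*} [Field E] [Field E'] [Algebra k E] [Algebra k E']
    (a : G →* Gal(E/k)) (a' : G →* Gal(E'/k)) (e : E ≃ₐ[k] E')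
    (he : ∀ g x, e (a g x) = a' g (e x)) :
    Nonempty (IntermediateField.fixedField a.range ≃ₐ[k] IntermediateField.fixedField a'.range) := by
  have h : (IntermediateField.fixedField a.range).map e.toAlgHom =
      IntermediateField.fixedField a'.range := by
    ext y
    rw [IntermediateField.mem_map]
    constructor
    · rintro ⟨x, hx, rfl⟩
      rw [mem_fixedField_range] at hx ⊢
      intro g
      exact (he g x).symm.trans (congrArg e (hx g))
    · intro hy
      rw [mem_fixedField_range] at hy
      refine ⟨e.symm y, ?_, e.apply_symm_apply y⟩
      rw [mem_fixedField_range]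
      intro g
      apply e.injective
      rw [he, e.apply_symm_apply, hy]
  exact ⟨(IntermediateField.intermediateFieldMap e _).trans (IntermediateField.equivOfEq h)⟩

omit [IsScalarTower k k' Ω] in
theorem mem_adjoin_of_semilinear (ρ : G →* Gal(k'/k)) (a : G →* Gal(Ω/k))
    (hρ : ∀ g c, a g (algebraMap k' Ω c) = algebraMap k' Ω (ρ g c)) {S : Set Ω}
    (hS : ∀ g, ∀ x ∈ S, a g x ∈ IntermediateField.adjoin k' S) (g : G) (x : Ω)
    (hx : x ∈ IntermediateField.adjoin k' S) : a g x ∈ IntermediateField.adjoin k' S := by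
  induction hx using IntermediateField.adjoin_induction with
  | mem x hx => exact hS g x hx
  | algebraMap c => rw [hρ]; exact IntermediateField.algebraMap_mem _ _
  | add x y _ _ hx hy => rw [map_add]; exact add_mem hx hy
  | inv x _ hx => rw [map_inv₀]; exact inv_mem hx
  | mul x y _ _ hx hy => rw [map_mul]; exact mul_mem hx hy

/-- The no-name lemma over the subfield `L = k'(w)`, for the family `y` of linear generators. -/
theorem fixedField_equiv_of_adjoin [Finite G] (a : G →* Gal(Ω/k)) {X κ : Type*} [Finite X]
    [Finite κ] {w : X → Ω} (hw : AlgebraicIndependent k' w)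
    (hL : ∀ g, ∀ x ∈ IntermediateField.adjoin k' (Set.range w),
      a g x ∈ IntermediateField.adjoin k' (Set.range w))
    (hfaith : Injective (restrictAction a _ hL)) (y : κ → Ω)
    (hy : ∀ g i, a g (y i) ∈
      Submodule.span (IntermediateField.adjoin k' (Set.range w)) (Set.range y))
    (h1 : (1 : Ω) ∈ Submodule.span (IntermediateField.adjoin k' (Set.range w)) (Set.range y))
    (htop : IntermediateField.adjoin k' (Set.range w ∪ Set.range y) = ⊤) (d : ℕ)
    (hdim : Module.finrank (IntermediateField.adjoin k' (Set.range w))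
      (Submodule.span (IntermediateField.adjoin k' (Set.range w)) (Set.range y)) ≤ d + 1)
    (htrdeg : ((Nat.card X + d : ℕ) : Cardinal) ≤ Algebra.trdeg k' Ω) :
    Nonempty (IntermediateField.fixedField a.range ≃ₐ[k] FractionRing (MvPolynomial (Fin d)
      (IntermediateField.fixedField (restrictAction a _ hL).range))) := by
  set L := IntermediateField.adjoin k' (Set.range w) with hLdef
  set V := Submodule.span L (Set.range y) with hVdef
  have hkL : IsScalarTower k L Ω := .of_algebraMap_eq fun x => rfl
  have hfin : FiniteDimensional L V := FiniteDimensional.span_of_finite L (Set.finite_range y)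
  refine fixedField_equiv_of_stable_subspace (restrictAction a L hL) a (fun g x => rfl) hfaith V
    ?_ h1 ?_ d hdim ?_
  · intro g v hv
    induction hv using Submodule.span_induction with
    | mem v hv => obtain ⟨i, rfl⟩ := hv; exact hy g i
    | zero => rw [map_zero]; exact zero_mem V
    | add u v _ _ hu hv => rw [map_add]; exact add_mem hu hv
    | smul c v _ hv =>
      rw [Algebra.smul_def, map_mul]
      have h : a g (algebraMap L Ω c) = algebraMap L Ω (restrictAction a L hL g c) := rfl
      rw [h, ← Algebra.smul_def]
      exact V.smul_mem _ hv
  · have h : (⊤ : IntermediateField k' Ω) ≤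
        (IntermediateField.adjoin L (V : Set Ω)).restrictScalars k' := by
      rw [← htop, IntermediateField.adjoin_le_iff]
      rintro x (hx | hx)
      · exact (IntermediateField.adjoin L (V : Set Ω)).algebraMap_mem
          ⟨x, IntermediateField.subset_adjoin k' (Set.range w) hx⟩
      · exact IntermediateField.subset_adjoin L (V : Set Ω) (Submodule.subset_span hx)
    rw [← top_le_iff]
    intro x _
    exact h (IntermediateField.mem_top (F := k') (x := x))
  · have h1 : Algebra.trdeg k' L = (Nat.card X : Cardinal) :=
      ((isRationalBasis_X k' X).map hw.aevalEquivField).trdeg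
    rw [← trdeg_add_eq k' L (A := Ω), h1, Nat.cast_add, add_comm, add_comm _ (Algebra.trdeg L Ω)]
      at htrdeg
    exact (Cardinal.add_nat_le_add_nat_iff _).mp htrdeg

end Restrict

section Permutation

variable {k k' Ω Ω' G X : Type*} [Field k] [Field k'] [Field Ω] [Field Ω'] [Algebra k k']
  [Algebra k Ω] [Algebra k' Ω] [IsScalarTower k k' Ω] [Algebra k Ω'] [Algebra k' Ω']
  [IsScalarTower k k' Ω'] [Group G]

omit [IsScalarTower k k' Ω] in
theorem mem_adjoin_of_permutation (ρ : G →* Gal(k'/k)) (a : G →* Gal(Ω/k))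
    (hρ : ∀ g c, a g (algebraMap k' Ω c) = algebraMap k' Ω (ρ g c)) (θ : G →* Equiv.Perm X)
    {w : X → Ω} (hw : ∀ g x, a g (w x) = w (θ g x)) (g : G) (x : Ω)
    (hx : x ∈ IntermediateField.adjoin k' (Set.range w)) :
    a g x ∈ IntermediateField.adjoin k' (Set.range w) := by
  refine mem_adjoin_of_semilinear ρ a hρ ?_ g x hx
  rintro g _ ⟨x, rfl⟩
  rw [hw]
  exact IntermediateField.subset_adjoin _ _ ⟨_, rfl⟩

theorem restrictAction_injective_of_permutation (a : G →* Gal(Ω/k)) (θ : G →* Equiv.Perm X)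
    (hθ : Injective θ) {w : X → Ω} (hw : ∀ g x, a g (w x) = w (θ g x)) (hinj : Injective w)
    (hL : ∀ g, ∀ x ∈ IntermediateField.adjoin k' (Set.range w),
      a g x ∈ IntermediateField.adjoin k' (Set.range w)) :
    Injective (restrictAction a _ hL) := by
  rw [injective_iff_map_eq_one]
  intro g hg
  apply hθ
  rw [map_one]
  ext x
  apply hinj
  rw [← hw]
  exact congrArg Subtype.val (DFunLike.congr_fun hg
    ⟨w x, IntermediateField.subset_adjoin _ _ ⟨x, rfl⟩⟩)

/-- Two subfields generated by algebraically independent elements that `G` permutes in the same way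
have isomorphic fields of invariants. -/
theorem fixedField_restrictAction_equiv (ρ : G →* Gal(k'/k)) (a : G →* Gal(Ω/k))
    (hρ : ∀ g c, a g (algebraMap k' Ω c) = algebraMap k' Ω (ρ g c))
    (a' : G →* Gal(Ω'/k)) (hρ' : ∀ g c, a' g (algebraMap k' Ω' c) = algebraMap k' Ω' (ρ g c))
    (θ : G →* Equiv.Perm X) {w : X → Ω} {w' : X → Ω'} (hw : ∀ g x, a g (w x) = w (θ g x))
    (hw' : ∀ g x, a' g (w' x) = w' (θ g x)) (hind : AlgebraicIndependent k' w)
    (hind' : AlgebraicIndependent k' w') :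
    Nonempty (IntermediateField.fixedField (restrictAction a _
        (mem_adjoin_of_permutation ρ a hρ θ hw)).range ≃ₐ[k]
      IntermediateField.fixedField (restrictAction a' _
        (mem_adjoin_of_permutation ρ a' hρ' θ hw')).range) := by
  let e := hind.aevalEquivField.symm.trans hind'.aevalEquivField
  have hmem : ∀ x, w x ∈ IntermediateField.adjoin k' (Set.range w) := fun x =>
    IntermediateField.subset_adjoin _ _ ⟨x, rfl⟩
  have hmem' : ∀ x, w' x ∈ IntermediateField.adjoin k' (Set.range w') := fun x =>
    IntermediateField.subset_adjoin _ _ ⟨x, rfl⟩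
  have he : ∀ x, e ⟨w x, hmem x⟩ = ⟨w' x, hmem' x⟩ := by
    intro x
    have h1 : hind.aevalEquivField (algebraMap _ _ (MvPolynomial.X x)) = ⟨w x, hmem x⟩ :=
      Subtype.ext (by rw [hind.aevalEquivField_algebraMap_apply_coe, MvPolynomial.aeval_X])
    have h2 : hind'.aevalEquivField (algebraMap _ _ (MvPolynomial.X x)) = ⟨w' x, hmem' x⟩ :=
      Subtype.ext (by rw [hind'.aevalEquivField_algebraMap_apply_coe, MvPolynomial.aeval_X])
    rw [← h1, AlgEquiv.trans_apply, AlgEquiv.symm_apply_apply, h2]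
  refine fixedField_equiv_congr _ _ (e.restrictScalars k) ?_
  rintro g ⟨x, hx⟩
  change e (restrictAction a _ _ g ⟨x, hx⟩) = restrictAction a' _ _ g (e ⟨x, hx⟩)
  induction hx using IntermediateField.adjoin_induction with
  | mem x hx =>
    obtain ⟨x, rfl⟩ := hx
    have h1 : restrictAction a _ (mem_adjoin_of_permutation ρ a hρ θ hw) g ⟨w x, hmem x⟩ =
        ⟨w (θ g x), hmem _⟩ := Subtype.ext (hw g x)
    have h2 : restrictAction a' _ (mem_adjoin_of_permutation ρ a' hρ' θ hw') g ⟨w' x, hmem' x⟩ =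
        ⟨w' (θ g x), hmem' _⟩ := Subtype.ext (hw' g x)
    exact (congrArg e h1).trans ((he _).trans (h2.symm.trans (congrArg _ (he x).symm)))
  | algebraMap c =>
    have h1 : restrictAction a _ (mem_adjoin_of_permutation ρ a hρ θ hw) g
        (algebraMap k' (IntermediateField.adjoin k' (Set.range w)) c) =
          algebraMap k' _ (ρ g c) := Subtype.ext (hρ g c)
    have h2 : restrictAction a' _ (mem_adjoin_of_permutation ρ a' hρ' θ hw') g
        (algebraMap k' (IntermediateField.adjoin k' (Set.range w')) c) =
          algebraMap k' _ (ρ g c) := Subtype.ext (hρ' g c)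
    exact (congrArg e h1).trans ((e.commutes _).trans
      (h2.symm.trans (congrArg _ (e.commutes c).symm)))
  | add x y hx hy ihx ihy =>
    change e (restrictAction a _ _ g (⟨x, hx⟩ + ⟨y, hy⟩)) =
      restrictAction a' _ _ g (e (⟨x, hx⟩ + ⟨y, hy⟩))
    simp only [map_add, ihx, ihy]
  | inv x hx ih =>
    change e (restrictAction a _ _ g (⟨x, hx⟩⁻¹)) = restrictAction a' _ _ g (e (⟨x, hx⟩⁻¹))
    simp only [map_inv₀, ih]
  | mul x y hx hy ihx ihy =>
    change e (restrictAction a _ _ g (⟨x, hx⟩ * ⟨y, hy⟩)) =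
      restrictAction a' _ _ g (e (⟨x, hx⟩ * ⟨y, hy⟩))
    simp only [map_mul, ihx, ihy]

end Permutation

/-! ### The field of the relation module of the dihedral group -/

section RelationField

variable {k k' : Type*} [Field k] [Field k'] [Algebra k k'] (n : ℕ)

/-- The action of `Dₙ` on the cosets of `⟨τ⟩`, where `c` stands for the coset of `σᶜ`. -/
def dihedralPerm : DihedralGroup n →* Equiv.Perm (ZMod n) where
  toFun g := match g with
    | .r i => Equiv.addLeft i
    | .sr i => (Equiv.addLeft i).trans (Equiv.neg _)
  map_one' := by
    ext c
    change (0 : ZMod n) + c = c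
    rw [zero_add]
  map_mul' := by
    rintro (i | i) (j | j) <;> ext c
    · change i + j + c = i + (j + c)
      ring
    · change -(j - i + c) = i + -(j + c)
      ring
    · change -(i + j + c) = -(i + (j + c))
      ring
    · change j - i + c = -(i + -(j + c))
      ring

theorem dihedralPerm_r (i c : ZMod n) : dihedralPerm n (DihedralGroup.r i) c = i + c := rfl

theorem dihedralPerm_sr (i c : ZMod n) : dihedralPerm n (DihedralGroup.sr i) c = -(i + c) := rfl

theorem eq_one_of_dihedralPerm_eq (hn : 3 ≤ n) {g : DihedralGroup n}
    (h0 : dihedralPerm n g 0 = 0) (h1 : dihedralPerm n g 1 = 1) : g = 1 := by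
  rcases g with i | i
  · rw [dihedralPerm_r, add_zero] at h0
    rw [h0, DihedralGroup.r_zero]
  · exfalso
    rw [dihedralPerm_sr] at h0 h1
    have h2 : ((2 : ℕ) : ZMod n) = 0 := by
      push_cast
      linear_combination h0 - h1
    have h3 := Nat.le_of_dvd (by norm_num) ((ZMod.natCast_eq_zero_iff 2 n).mp h2)
    omega

theorem dihedralPerm_injective (hn : 3 ≤ n) : Injective (dihedralPerm n) := by
  rw [injective_iff_map_eq_one]
  exact fun g h => eq_one_of_dihedralPerm_eq n hn (DFunLike.congr_fun h 0)
    (DFunLike.congr_fun h 1)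

theorem isRationalBasis_relationBasis (k' : Type*) [Field k'] [NeZero n] :
    IsRationalBasis k' fun i => latticeMonomial k' (relationBasis n i) :=
  isRationalBasis_latticeMonomial (linearIndependent_relationBasis n) (span_relationBasis n)

variable (k') in
/-- The invariant `s = ∑ D_c`, the sum of the variables `D_c` that belong to the relators conjugate
to `(s₁ s₂)²`. -/
def productSum [NeZero n] : LatticeField k' (RelationModule (dihedralPresentation n)) :=
  ∑ c, latticeMonomial k' (productClass n c)

theorem productSum_ne_zero [NeZero n] : productSum k' n ≠ 0 := by
  have h := (isRationalBasis_relationBasis n k').indep.linearIndependent.comp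
    (fun c : ZMod n => Sum.inr (Sum.inr c)) (Sum.inr_injective.comp Sum.inr_injective)
  intro h0
  have h1 := Fintype.linearIndependent_iff.mp h (fun _ => 1) (by simp only [one_smul]; exact h0) 0
  exact one_ne_zero h1

variable (k') in
/-- The elements `U = A / s^((n-1)/2)`, for the two variables `A` that belong to the conjugates of
`s₁ⁿ`, and `V_c = D_c / s`. The group `Dₙ` permutes them, the `V_c` add up to `1`, and `s` can be
recovered from them. -/
def relationGenerator [NeZero n] :
    Bool ⊕ ZMod n → LatticeField k' (RelationModule (dihedralPresentation n)) :=
  Sum.elim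
    (fun b => latticeMonomial k' (bif b then rotationClass' n else rotationClass n) /
      productSum k' n ^ (n / 2))
    (fun c => latticeMonomial k' (productClass n c) / productSum k' n)

theorem latticeFieldAction_reflectionClass (ρ : DihedralGroup n →* Gal(k'/k))
    (g : DihedralGroup n) (c : ZMod n) :
    latticeFieldAction ρ (dihedralRelationRep n) g (latticeMonomial k' (reflectionClass n c)) =
      latticeMonomial k' (reflectionClass n (dihedralPerm n g c)) := by
  rw [latticeFieldAction_monomial]
  rcases g with i | i
  · rw [dihedralRelationRep_r_reflectionClass, dihedralPerm_r]
  · rw [dihedralRelationRep_sr_reflectionClass, dihedralPerm_sr]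

theorem exists_dihedralRelationRep_productClass (g : DihedralGroup n) :
    ∃ e : Equiv.Perm (ZMod n),
      ∀ c, dihedralRelationRep n g (productClass n c) = productClass n (e c) := by
  rcases g with i | i
  · exact ⟨Equiv.addLeft i, fun c => dihedralRelationRep_r_productClass n i c⟩
  · exact ⟨(Equiv.addLeft i).trans (Equiv.subLeft (-1)),
      fun c => dihedralRelationRep_sr_productClass n i c⟩

theorem latticeFieldAction_productSum [NeZero n] (ρ : DihedralGroup n →* Gal(k'/k))
    (g : DihedralGroup n) :
    latticeFieldAction ρ (dihedralRelationRep n) g (productSum k' n) = productSum k' n := by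
  obtain ⟨e, he⟩ := exists_dihedralRelationRep_productClass n g
  rw [productSum, map_sum]
  refine Fintype.sum_equiv e _ _ fun c => ?_
  rw [latticeFieldAction_monomial, he]

theorem latticeFieldAction_relationGenerator_mem [NeZero n] (ρ : DihedralGroup n →* Gal(k'/k))
    (g : DihedralGroup n) (i : Bool ⊕ ZMod n) :
    latticeFieldAction ρ (dihedralRelationRep n) g (relationGenerator k' n i) ∈
      Set.range (relationGenerator k' n) := by
  rcases i with b | c
  · have h : ∃ b', dihedralRelationRep n g (bif b then rotationClass' n else rotationClass n) =
        bif b' then rotationClass' n else rotationClass n := by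
      rcases g with i | i <;> cases b
      · exact ⟨false, dihedralRelationRep_r_rotationClass n i⟩
      · exact ⟨true, dihedralRelationRep_r_rotationClass' n i⟩
      · exact ⟨true, dihedralRelationRep_sr_rotationClass n i⟩
      · exact ⟨false, dihedralRelationRep_sr_rotationClass' n i⟩
    obtain ⟨b', hb'⟩ := h
    refine ⟨Sum.inl b', ?_⟩
    change _ = latticeFieldAction ρ (dihedralRelationRep n) g (_ / _)
    rw [map_div₀, map_pow, latticeFieldAction_productSum, latticeFieldAction_monomial, hb']
    rfl
  · obtain ⟨e, he⟩ := exists_dihedralRelationRep_productClass n g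
    refine ⟨Sum.inr (e c), ?_⟩
    change _ = latticeFieldAction ρ (dihedralRelationRep n) g (_ / _)
    rw [map_div₀, latticeFieldAction_productSum, latticeFieldAction_monomial, he]
    rfl

theorem sum_relationGenerator [NeZero n] :
    ∑ c, relationGenerator k' n (Sum.inr c) = 1 := by
  change ∑ c, latticeMonomial k' (productClass n c) / productSum k' n = 1
  rw [← Finset.sum_div]
  exact div_self (productSum_ne_zero n)

/-- Multiplicatively, the identity among the relators says `A A' ∏ B_c = ∏ D_c`. As `n` is odd,
this gives `U U' ∏ B_c = s ∏ V_c`, so that `s` is a rational function of the `B_c`, `U`, `V_c`. -/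
theorem adjoin_relationGenerator [NeZero n] (hodd : Odd n) :
    IntermediateField.adjoin k' (Set.range (fun c => latticeMonomial k' (reflectionClass n c)) ∪
      Set.range (relationGenerator k' n)) = ⊤ := by
  set T := IntermediateField.adjoin k' (Set.range (fun c => latticeMonomial k'
    (reflectionClass n c)) ∪ Set.range (relationGenerator k' n)) with hT
  have hs0 := productSum_ne_zero (k' := k') n
  have hB : ∀ c, latticeMonomial k' (reflectionClass n c) ∈ T := fun c =>
    IntermediateField.subset_adjoin _ _ (Or.inl ⟨c, rfl⟩)
  have hU : ∀ i, relationGenerator k' n i ∈ T := fun i =>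
    IntermediateField.subset_adjoin _ _ (Or.inr ⟨i, rfl⟩)
  have hrel : latticeMonomial k' (rotationClass n) * latticeMonomial k' (rotationClass' n) *
      ∏ c, latticeMonomial k' (reflectionClass n c) =
        ∏ c, latticeMonomial k' (productClass n c) := by
    rw [← latticeMonomial_sum, ← latticeMonomial_sum, ← latticeMonomial_add,
      ← latticeMonomial_add, rotationClass_add_rotationClass']
  have hs : productSum k' n = relationGenerator k' n (Sum.inl false) *
      relationGenerator k' n (Sum.inl true) * (∏ c, latticeMonomial k' (reflectionClass n c)) /
        ∏ c, relationGenerator k' n (Sum.inr c) := by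
    change productSum k' n = latticeMonomial k' (rotationClass n) / productSum k' n ^ (n / 2) *
      (latticeMonomial k' (rotationClass' n) / productSum k' n ^ (n / 2)) *
      (∏ c, latticeMonomial k' (reflectionClass n c)) /
        ∏ c, latticeMonomial k' (productClass n c) / productSum k' n
    have hD0 : ∏ c, latticeMonomial k' (productClass n c) ≠ 0 :=
      Finset.prod_ne_zero_iff.mpr fun c _ => latticeMonomial_ne_zero _
    have hpow : productSum k' n ^ n =
        productSum k' n ^ (n / 2) * productSum k' n ^ (n / 2) * productSum k' n := by
      rw [← pow_add, ← pow_succ]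
      congr 1
      obtain ⟨m, hm⟩ := hodd
      omega
    rw [Finset.prod_div_distrib, Finset.prod_const, Finset.card_univ, ZMod.card, hpow, ← hrel]
    rw [← hrel] at hD0
    have h1 := left_ne_zero_of_mul hD0
    have h2 := right_ne_zero_of_mul hD0
    have h3 := left_ne_zero_of_mul h1
    have h4 := right_ne_zero_of_mul h1
    field_simp
  have hsT : productSum k' n ∈ T := by
    rw [hs]
    exact div_mem (mul_mem (mul_mem (hU _) (hU _)) (prod_mem fun c _ => hB c))
      (prod_mem fun c _ => hU _)
  rw [← top_le_iff, ← (isRationalBasis_relationBasis n k').adjoin_eq_top,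
    IntermediateField.adjoin_le_iff]
  rintro _ ⟨_ | c | c, rfl⟩
  · have h : latticeMonomial k' (rotationClass n) =
        relationGenerator k' n (Sum.inl false) * productSum k' n ^ (n / 2) :=
      (div_mul_cancel₀ _ (pow_ne_zero _ hs0)).symm
    change latticeMonomial k' (rotationClass n) ∈ T
    rw [h]
    exact mul_mem (hU _) (pow_mem hsT _)
  · exact hB c
  · have h : latticeMonomial k' (productClass n c) =
        relationGenerator k' n (Sum.inr c) * productSum k' n :=
      (div_mul_cancel₀ _ hs0).symm
    change latticeMonomial k' (productClass n c) ∈ T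
    rw [h]
    exact mul_mem (hU _) hsT

theorem trdeg_relationField (k' : Type*) [Field k'] [NeZero n] :
    Algebra.trdeg k' (LatticeField k' (RelationModule (dihedralPresentation n))) =
      ((2 * n + 1 : ℕ) : Cardinal) := by
  rw [(isRationalBasis_relationBasis n k').trdeg]
  congr 1
  simp
  ring

theorem algebraicIndependent_reflectionClass (k' : Type*) [Field k'] [NeZero n] :
    AlgebraicIndependent k' fun c => latticeMonomial k' (reflectionClass n c) :=
  (isRationalBasis_relationBasis n k').indep.comp (fun c : ZMod n => Sum.inr (Sum.inl c))
    (Sum.inr_injective.comp Sum.inl_injective)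

/-- The invariants of `k'(R^ab)`, over the invariants of the field `L` of the permutation lattice on
the cosets of `⟨τ⟩`. -/
theorem latticeFixedField_relation_equiv (hodd : Odd n) (hn : 3 ≤ n)
    (ρ : DihedralGroup n →* Gal(k'/k)) :
    Nonempty (latticeFixedField ρ (dihedralRelationRep n) ≃ₐ[k]
      FractionRing (MvPolynomial (Fin (n + 1)) (IntermediateField.fixedField
        (restrictAction (latticeFieldAction ρ (dihedralRelationRep n)) _
          (mem_adjoin_of_permutation ρ (latticeFieldAction ρ (dihedralRelationRep n))
            (latticeFieldAction_algebraMap ρ _) (dihedralPerm n)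
            (latticeFieldAction_reflectionClass n ρ))).range))) := by
  have : NeZero n := ⟨by omega⟩
  refine fixedField_equiv_of_adjoin (latticeFieldAction ρ (dihedralRelationRep n))
    (algebraicIndependent_reflectionClass n k') _
    (restrictAction_injective_of_permutation _ (dihedralPerm n) (dihedralPerm_injective n hn)
      (latticeFieldAction_reflectionClass n ρ)
      (algebraicIndependent_reflectionClass n k').injective _)
    (relationGenerator k' n) ?_ ?_ (adjoin_relationGenerator n hodd) (n + 1) ?_ ?_
  · exact fun g i => Submodule.subset_span (latticeFieldAction_relationGenerator_mem n ρ g i)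
  · rw [← sum_relationGenerator n]
    exact sum_mem fun c _ => Submodule.subset_span ⟨_, rfl⟩
  · refine (finrank_range_le_card (relationGenerator k' n)).trans ?_
    rw [Fintype.card_sum, Fintype.card_bool, ZMod.card]
    omega
  · rw [trdeg_relationField, Nat.card_zmod]
    exact Nat.cast_le.mpr (by omega)

/-- If `Dₙ` acts faithfully on `K`, the no-name lemma applies over `K` itself. -/
theorem isRationalField_relation_of_equiv (hodd : Odd n) (K : Type*) [Field K] [Algebra k K]
    [FiniteDimensional k K] [IsGalois k K] (ρ : DihedralGroup n ≃* Gal(K/k)) :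
    IsRationalField k (latticeFixedField ρ.toMonoidHom (dihedralRelationRep n)) := by
  have : NeZero n := ⟨by rintro rfl; exact absurd hodd (by decide)⟩
  set a := latticeFieldAction ρ.toMonoidHom (dihedralRelationRep n) with ha
  set y : ZMod n ⊕ (Bool ⊕ ZMod n) → LatticeField K (RelationModule (dihedralPresentation n)) :=
    Sum.elim (fun c => latticeMonomial K (reflectionClass n c)) (relationGenerator K n) with hy
  set V := Submodule.span K (Set.range y) with hV
  have hfin : FiniteDimensional K V := FiniteDimensional.span_of_finite K (Set.finite_range y)
  have hact : ∀ g i, a g (y i) ∈ V := by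
    rintro g (c | i)
    · refine Submodule.subset_span ⟨Sum.inl (dihedralPerm n g c), ?_⟩
      exact (latticeFieldAction_reflectionClass n ρ.toMonoidHom g c).symm
    · obtain ⟨j, hj⟩ := latticeFieldAction_relationGenerator_mem n ρ.toMonoidHom g i
      exact Submodule.subset_span ⟨Sum.inr j, hj⟩
  obtain ⟨e⟩ := fixedField_equiv_of_stable_subspace ρ.toMonoidHom a
    (latticeFieldAction_algebraMap ρ.toMonoidHom _) ρ.injective V (by
      intro g v hv
      induction hv using Submodule.span_induction with
      | mem v hv => obtain ⟨i, rfl⟩ := hv; exact hact g i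
      | zero => rw [map_zero]; exact zero_mem V
      | add u v _ _ hu hv => rw [map_add]; exact add_mem hu hv
      | smul c v _ hv =>
        rw [Algebra.smul_def, map_mul, latticeFieldAction_algebraMap, ← Algebra.smul_def]
        exact V.smul_mem _ hv) (by
      rw [← sum_relationGenerator n]
      exact sum_mem fun c _ => Submodule.subset_span ⟨Sum.inr (Sum.inr c), rfl⟩) (by
      rw [← top_le_iff, ← adjoin_relationGenerator n hodd, IntermediateField.adjoin_le_iff]
      rintro _ (⟨c, rfl⟩ | ⟨i, rfl⟩)
      · exact IntermediateField.subset_adjoin _ _ (Submodule.subset_span ⟨Sum.inl c, rfl⟩)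
      · exact IntermediateField.subset_adjoin _ _ (Submodule.subset_span ⟨Sum.inr i, rfl⟩))
    (2 * n + 1) (by
      refine (finrank_range_le_card y).trans ?_
      rw [Fintype.card_sum, Fintype.card_sum, Fintype.card_bool, ZMod.card]
      omega) (trdeg_relationField n K).ge
  have hbot : IntermediateField.fixedField ρ.toMonoidHom.range = (⊥ : IntermediateField k K) := by
    have h : ρ.toMonoidHom.range = ⊤ := MonoidHom.range_eq_top.mpr ρ.surjective
    rw [h, IsGalois.fixedField_top]
  obtain ⟨f⟩ := fractionRing_mvPolynomial_equiv_congr (Fin (2 * n + 1))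
    ((IntermediateField.equivOfEq hbot).trans (IntermediateField.botEquiv k K))
  exact ⟨2 * n + 1, ⟨e.trans f⟩⟩

end RelationField

/-! ### The regular representation of the dihedral group -/

section Regular

variable {k k' Ω : Type*} [Field k] [Field k'] [Field Ω] [Algebra k k'] [Algebra k Ω]
  [Algebra k' Ω] [IsScalarTower k k' Ω] {n : ℕ}

/-- The sums of the variables `x` over the cosets of `⟨τ⟩`. -/
def cosetSum (x : DihedralGroup n → Ω) (c : ZMod n) : Ω :=
  x (DihedralGroup.r c) + x (DihedralGroup.sr (-c))

omit [Field k'] [Algebra k k'] [Algebra k' Ω] [IsScalarTower k k' Ω] in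
theorem map_cosetSum (a : DihedralGroup n →* Gal(Ω/k)) {x : DihedralGroup n → Ω}
    (hperm : ∀ g h, a g (x h) = x (g * h)) (g : DihedralGroup n) (c : ZMod n) :
    a g (cosetSum x c) = cosetSum x (dihedralPerm n g c) := by
  rcases g with i | i
  · rw [cosetSum, cosetSum, map_add, hperm, hperm, DihedralGroup.r_mul_r,
      DihedralGroup.r_mul_sr, dihedralPerm_r, neg_add_rev, sub_eq_add_neg]
  · rw [cosetSum, cosetSum, map_add, hperm, hperm, DihedralGroup.sr_mul_r,
      DihedralGroup.sr_mul_sr, dihedralPerm_sr, neg_neg, neg_add_rev, sub_eq_add_neg, add_comm]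

theorem adjoin_cosetSum {x : DihedralGroup n → Ω} (hx : IsRationalBasis k' x) :
    IntermediateField.adjoin k' (Set.range (cosetSum x) ∪
      Set.range fun c => x (DihedralGroup.r c)) = ⊤ := by
  rw [← top_le_iff, ← hx.adjoin_eq_top, IntermediateField.adjoin_le_iff]
  have hr : ∀ c, x (DihedralGroup.r c) ∈ IntermediateField.adjoin k' (Set.range (cosetSum x) ∪
      Set.range fun c => x (DihedralGroup.r c)) := fun c =>
    IntermediateField.subset_adjoin _ _ (Or.inr ⟨c, rfl⟩)
  rintro _ ⟨c | c, rfl⟩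
  · exact hr c
  · have h : x (DihedralGroup.sr c) = cosetSum x (-c) - x (DihedralGroup.r (-c)) := by
      rw [cosetSum, neg_neg, add_sub_cancel_left]
    rw [h]
    exact sub_mem (IntermediateField.subset_adjoin _ _ (Or.inl ⟨_, rfl⟩)) (hr _)

theorem algebraicIndependent_cosetSum [NeZero n] {x : DihedralGroup n → Ω}
    (hx : IsRationalBasis k' x) : AlgebraicIndependent k' (cosetSum x) := by
  have h : AlgebraicIndependent k' (Sum.elim (cosetSum x) fun c => x (DihedralGroup.r c)) := by
    refine algebraicIndependent_of_card_le_trdeg ?_ ?_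
    · rw [Set.Sum.elim_range, adjoin_cosetSum hx]
    · rw [hx.trdeg, Nat.card_sum, Nat.card_zmod, DihedralGroup.nat_card, two_mul]
  exact h.comp Sum.inl Sum.inl_injective

theorem fixedField_regular_equiv (hn : 3 ≤ n) (ρ : DihedralGroup n →* Gal(k'/k))
    (a : DihedralGroup n →* Gal(Ω/k))
    (hρ : ∀ g c, a g (algebraMap k' Ω c) = algebraMap k' Ω (ρ g c)) {x : DihedralGroup n → Ω}
    (hx : IsRationalBasis k' x) (hperm : ∀ g h, a g (x h) = x (g * h)) :
    Nonempty (IntermediateField.fixedField a.range ≃ₐ[k] FractionRing (MvPolynomial (Fin n)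
      (IntermediateField.fixedField (restrictAction a _
        (mem_adjoin_of_permutation ρ a hρ (dihedralPerm n) (map_cosetSum a hperm))).range))) := by
  have : NeZero n := ⟨by omega⟩
  set L := IntermediateField.adjoin k' (Set.range (cosetSum x)) with hL
  set y : Option (ZMod n) → Ω := fun o => o.elim 1 fun c => x (DihedralGroup.r c) with hy
  have h1 : (1 : Ω) ∈ Submodule.span L (Set.range y) := Submodule.subset_span ⟨none, rfl⟩
  have hw : ∀ c, cosetSum x c ∈ Submodule.span L (Set.range y) := by
    intro c
    have h := (Submodule.span L (Set.range y)).smul_mem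
      (⟨cosetSum x c, IntermediateField.subset_adjoin _ _ ⟨c, rfl⟩⟩ : L) h1
    rwa [Algebra.smul_def, mul_one] at h
  refine fixedField_equiv_of_adjoin a (algebraicIndependent_cosetSum hx) _
    (restrictAction_injective_of_permutation a (dihedralPerm n) (dihedralPerm_injective n hn)
      (map_cosetSum a hperm) (algebraicIndependent_cosetSum hx).injective _) y ?_ h1 ?_ n ?_ ?_
  · rintro (i | i) (_ | c)
    · exact (map_one (a _)).symm ▸ h1
    · change a _ (x _) ∈ _
      rw [hperm, DihedralGroup.r_mul_r]
      exact Submodule.subset_span ⟨some (i + c), rfl⟩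
    · exact (map_one (a _)).symm ▸ h1
    · change a _ (x _) ∈ _
      have h : x (DihedralGroup.sr (i + c)) =
          cosetSum x (-(i + c)) - x (DihedralGroup.r (-(i + c))) := by
        rw [cosetSum, neg_neg, add_sub_cancel_left]
      rw [hperm, DihedralGroup.sr_mul_r, h]
      exact sub_mem (hw _) (Submodule.subset_span ⟨some _, rfl⟩)
  · rw [← top_le_iff, ← adjoin_cosetSum hx]
    refine IntermediateField.adjoin.mono _ _ _ (Set.union_subset_union_right _ ?_)
    rintro _ ⟨c, rfl⟩
    exact ⟨some c, rfl⟩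
  · refine (finrank_range_le_card y).trans ?_
    rw [Fintype.card_option, ZMod.card]
  · rw [hx.trdeg, Nat.card_zmod, DihedralGroup.nat_card, two_mul]

/-- The fields `k'(R^ab)^{Dₙ}` and `k'(ℤ[Dₙ])^{Dₙ}` are purely transcendental, of degrees `n + 1` and
`n`, over one and the same field of invariants. -/
theorem latticeFixedField_relation_equiv_ratFunc (hodd : Odd n) (hn : 3 ≤ n)
    (ρ : DihedralGroup n →* Gal(k'/k)) (a : DihedralGroup n →* Gal(Ω/k))
    (hρ : ∀ g c, a g (algebraMap k' Ω c) = algebraMap k' Ω (ρ g c)) {x : DihedralGroup n → Ω}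
    (hx : IsRationalBasis k' x) (hperm : ∀ g h, a g (x h) = x (g * h)) :
    Nonempty (latticeFixedField ρ (dihedralRelationRep n) ≃ₐ[k]
      RatFunc (IntermediateField.fixedField a.range)) := by
  have : NeZero n := ⟨by omega⟩
  obtain ⟨e₁⟩ := latticeFixedField_relation_equiv n hodd hn ρ
  obtain ⟨e₂⟩ := fixedField_regular_equiv hn ρ a hρ hx hperm
  obtain ⟨f⟩ := fixedField_restrictAction_equiv ρ _
    (latticeFieldAction_algebraMap ρ (dihedralRelationRep n)) a hρ (dihedralPerm n)
    (latticeFieldAction_reflectionClass n ρ) (map_cosetSum a hperm)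
    (algebraicIndependent_reflectionClass n k') (algebraicIndependent_cosetSum hx)
  obtain ⟨f'⟩ := fractionRing_mvPolynomial_equiv_congr (Fin (n + 1)) f
  obtain ⟨e₂'⟩ := ratFunc_equiv_congr e₂
  obtain ⟨e₃⟩ := ratFunc_fractionRing_equiv k (IntermediateField.fixedField (restrictAction a _
    (mem_adjoin_of_permutation ρ a hρ (dihedralPerm n) (map_cosetSum a hperm))).range) n
  exact ⟨((e₁.trans f').trans e₃.symm).trans e₂'.symm⟩

end Regular

/-! ### Noether's problem for the dihedral group -/

section Noether

theorem isRationalField_self (k : Type*) [Field k] : IsRationalField k k := by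
  have h : IsRationalBasis k (fun i : Empty => (i.elim : k)) :=
    ⟨algebraicIndependent_empty_type, Subsingleton.elim _ _⟩
  exact h.isRationalField

/-- Lüroth's theorem for the subfields of a field generated by one transcendental element. -/
theorem isRationalField_of_ratFunc_equiv {k E : Type*} [Field k] [Field E] [Algebra k E]
    (e : RatFunc k ≃ₐ[k] E) (F : IntermediateField k E) : IsRationalField k F := by
  set F' : IntermediateField k (RatFunc k) := F.map e.symm.toAlgHom with hF'
  have f : F ≃ₐ[k] F' := IntermediateField.intermediateFieldMap e.symm F
  refine IsRationalField.congr ?_ f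
  by_cases h : F' = ⊥
  · exact (isRationalField_self k).congr
      ((IntermediateField.equivOfEq h).trans (IntermediateField.botEquiv k (RatFunc k)))
  · exact (isRationalBasis_ratFunc_X k).isRationalField.congr (RatFunc.Luroth.algEquiv h).symm

variable {k L : Type*} [Field k] [Field L] [Algebra k L] {n : ℕ} {ζ : L}

theorem exists_algebraMap_zpow_add (hζ0 : ζ ≠ 0) (hc : ζ + ζ⁻¹ ∈ (algebraMap k L).range) (j : ℤ) :
    ∃ c : k, algebraMap k L c = ζ ^ j + ζ ^ (-j) := by
  have hnat : ∀ m : ℕ, (∃ c : k, algebraMap k L c = ζ ^ m + (ζ ^ m)⁻¹) ∧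
      ∃ c : k, algebraMap k L c = ζ ^ (m + 1) + (ζ ^ (m + 1))⁻¹ := by
    obtain ⟨c₁, hc₁⟩ := hc
    intro m
    induction m with
    | zero => exact ⟨⟨2, by rw [map_ofNat]; norm_num⟩, ⟨c₁, by simpa using hc₁⟩⟩
    | succ m ih =>
      obtain ⟨⟨b, hb⟩, ⟨c, hc⟩⟩ := ih
      refine ⟨⟨c, hc⟩, ⟨c₁ * c - b, ?_⟩⟩
      rw [map_sub, map_mul, hb, hc, hc₁]
      field_simp
      ring
  obtain ⟨m, rfl | rfl⟩ := j.eq_nat_or_neg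
  · obtain ⟨c, hc⟩ := (hnat m).1
    exact ⟨c, by rw [hc, zpow_neg, zpow_natCast]⟩
  · obtain ⟨c, hc⟩ := (hnat m).1
    exact ⟨c, by rw [hc, neg_neg, zpow_neg, zpow_natCast, add_comm]⟩

theorem exists_algebraMap_zpow_sub (hζ0 : ζ ≠ 0) (hζ2 : ζ - ζ⁻¹ ≠ 0)
    (hc : ζ + ζ⁻¹ ∈ (algebraMap k L).range) (j : ℤ) :
    ∃ c : k, algebraMap k L c = (ζ ^ j - ζ ^ (-j)) / (ζ - ζ⁻¹) := by
  have hnat : ∀ m : ℕ, (∃ c : k, algebraMap k L c * (ζ - ζ⁻¹) = ζ ^ m - (ζ ^ m)⁻¹) ∧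
      ∃ c : k, algebraMap k L c * (ζ - ζ⁻¹) = ζ ^ (m + 1) - (ζ ^ (m + 1))⁻¹ := by
    obtain ⟨c₁, hc₁⟩ := hc
    intro m
    induction m with
    | zero => exact ⟨⟨0, by simp⟩, ⟨1, by simp⟩⟩
    | succ m ih =>
      obtain ⟨⟨b, hb⟩, ⟨c, hc⟩⟩ := ih
      refine ⟨⟨c, hc⟩, ⟨c₁ * c - b, ?_⟩⟩
      rw [map_sub, map_mul, sub_mul, mul_assoc, hb, hc, hc₁]
      field_simp
      ring
  obtain ⟨m, rfl | rfl⟩ := j.eq_nat_or_neg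
  · obtain ⟨c, hc⟩ := (hnat m).1
    exact ⟨c, by rw [eq_div_iff hζ2, hc, zpow_neg, zpow_natCast]⟩
  · obtain ⟨c, hc⟩ := (hnat m).1
    exact ⟨-c, by rw [eq_div_iff hζ2, map_neg, neg_mul, hc, neg_neg, zpow_neg, zpow_natCast,
      neg_sub]⟩

/-- The sequences `C j = ζ^j + ζ^(-j)` and `P j = (ζ^j - ζ^(-j)) / (ζ - ζ⁻¹)` have their values in `k`
if `ζ + ζ⁻¹` does. -/
theorem exists_cyclotomic_sequences (hodd : Odd n) (hn : 3 ≤ n) (hζ : IsPrimitiveRoot ζ n)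
    (hc : ζ + ζ⁻¹ ∈ (algebraMap k L).range) :
    ∃ C P : ZMod n → k, (∀ j, C (-j) = C j) ∧ C 0 ^ 2 ≠ C 1 ^ 2 ∧
      (∀ i j, C (j + i) = P j * C (1 + i) - P (j - 1) * C i) ∧ ∀ j, P j = 0 → j = 0 := by
  have hζ0 : ζ ≠ 0 := hζ.ne_zero (by omega)
  have hpow : ∀ j : ℤ, ζ ^ (2 * j) = 1 → (j : ZMod n) = 0 := by
    intro j hj
    rw [hζ.zpow_eq_one_iff_dvd] at hj
    rw [ZMod.intCast_zmod_eq_zero_iff_dvd]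
    refine IsCoprime.dvd_of_dvd_mul_left ?_ hj
    rw [Int.isCoprime_iff_gcd_eq_one]
    exact_mod_cast hodd.coprime_two_right
  have hζ2 : ζ - ζ⁻¹ ≠ 0 := by
    intro h
    have h1 : ζ ^ (2 * (1 : ℤ)) = 1 := by
      have h2 : ζ = ζ⁻¹ := sub_eq_zero.mp h
      rw [mul_one, zpow_two]
      nth_rewrite 2 [h2]
      exact mul_inv_cancel₀ hζ0
    have h2 : ((1 : ℕ) : ZMod n) = 0 := by exact_mod_cast hpow 1 h1
    have h3 := Nat.le_of_dvd one_pos ((ZMod.natCast_eq_zero_iff 1 n).mp h2)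
    omega
  have hper : ∀ i j : ℤ, (i : ZMod n) = j → ζ ^ i = ζ ^ j := by
    intro i j hij
    have h1 : (n : ℤ) ∣ i - j := (ZMod.intCast_eq_intCast_iff_dvd_sub j i n).mp hij.symm
    have h2 := (hζ.zpow_eq_one_iff_dvd _).mpr h1
    rw [zpow_sub₀ hζ0, div_eq_one_iff_eq (zpow_ne_zero _ hζ0)] at h2
    exact h2
  choose C' hC' using exists_algebraMap_zpow_add hζ0 hc
  choose P' hP' using exists_algebraMap_zpow_sub hζ0 hζ2 hc
  have hC : ∀ j : ℤ, algebraMap k L (C' ((j : ZMod n).cast)) = ζ ^ j + ζ ^ (-j) := by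
    intro j
    rw [hC', hper _ j (ZMod.intCast_zmod_cast _), hper (-_) (-j) (by
      rw [Int.cast_neg, Int.cast_neg, ZMod.intCast_zmod_cast])]
  have hP : ∀ j : ℤ, algebraMap k L (P' ((j : ZMod n).cast)) = (ζ ^ j - ζ ^ (-j)) / (ζ - ζ⁻¹) := by
    intro j
    rw [hP', hper _ j (ZMod.intCast_zmod_cast _), hper (-_) (-j) (by
      rw [Int.cast_neg, Int.cast_neg, ZMod.intCast_zmod_cast])]
  refine ⟨fun j => C' j.cast, fun j => P' j.cast, ?_, ?_, ?_, ?_⟩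
  · intro j
    obtain ⟨j, rfl⟩ := ZMod.intCast_surjective j
    apply (algebraMap k L).injective
    have h1 := hC (-j)
    rw [Int.cast_neg] at h1
    rw [h1, hC, neg_neg, add_comm]
  · intro h
    have h0 := hC 0
    have h1 := hC 1
    rw [Int.cast_zero] at h0
    rw [Int.cast_one] at h1
    have h2 := congrArg (algebraMap k L) h
    rw [map_pow, map_pow, h0, h1] at h2
    apply hζ2
    have h3 : (ζ - ζ⁻¹) ^ 2 = 0 := by
      simp only [zpow_zero, neg_zero, zpow_one, zpow_neg] at h2
      have h4 := mul_inv_cancel₀ hζ0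
      linear_combination -h2 - 4 * h4
    exact pow_eq_zero_iff two_ne_zero |>.mp h3
  · intro i j
    obtain ⟨i, rfl⟩ := ZMod.intCast_surjective i
    obtain ⟨j, rfl⟩ := ZMod.intCast_surjective j
    apply (algebraMap k L).injective
    have h1 := hC (j + i)
    have h2 := hC (1 + i)
    have h3 := hP (j - 1)
    push_cast at h1 h2 h3
    rw [map_sub, map_mul, map_mul, h1, h2, h3, hC, hP]
    have hi := zpow_ne_zero i hζ0
    have hj := zpow_ne_zero j hζ0
    simp only [neg_add_rev, neg_sub, zpow_add₀ hζ0, zpow_sub₀ hζ0, zpow_neg, zpow_one]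
    rw [div_mul_eq_mul_div, div_mul_eq_mul_div, ← sub_div, eq_div_iff hζ2]
    field_simp
    ring
  · intro j hj
    obtain ⟨j, rfl⟩ := ZMod.intCast_surjective j
    change P' ((j : ZMod n).cast) = 0 at hj
    have h1 := hP j
    rw [hj, map_zero, eq_comm, div_eq_zero_iff, or_iff_left hζ2, sub_eq_zero] at h1
    apply hpow
    rw [two_mul, zpow_add₀ hζ0]
    nth_rewrite 2 [h1]
    rw [zpow_neg]
    exact mul_inv_cancel₀ (zpow_ne_zero _ hζ0)

end Noether

section TwoDimensional

variable {k Ω : Type*} [Field k] [Field Ω] [Algebra k Ω] {n : ℕ} [NeZero n] {C P : ZMod n → k}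
  {x : DihedralGroup n → Ω}

/-- The linear forms `ℓ_j` in the variables `x` with coefficients from an even sequence `C`. If `C`
satisfies the recursion of `ζ^j + ζ^(-j)`, they span the two-dimensional representation of `Dₙ` in
which `σ` has the eigenvalues `ζ` and `ζ⁻¹`. -/
def dihedralForm (C : ZMod n → k) (x : DihedralGroup n → Ω) (j : ZMod n) : Ω :=
  ∑ h, C (dihedralPerm n h⁻¹ j) • x h

theorem map_dihedralForm (a : DihedralGroup n →* Gal(Ω/k))
    (hperm : ∀ g h, a g (x h) = x (g * h)) (g : DihedralGroup n) (j : ZMod n) :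
    a g (dihedralForm C x j) = dihedralForm C x (dihedralPerm n g j) := by
  rw [dihedralForm, dihedralForm, map_sum]
  refine Fintype.sum_equiv (Equiv.mulLeft g) _ _ fun h => ?_
  rw [map_smul, hperm, Equiv.coe_mulLeft, mul_inv_rev, map_mul, Equiv.Perm.mul_apply,
    ← Equiv.Perm.mul_apply _ (dihedralPerm n g), ← map_mul, inv_mul_cancel, map_one]
  rfl

theorem dihedralForm_eq (heven : ∀ j, C (-j) = C j)
    (hCP : ∀ i j, C (j + i) = P j * C (1 + i) - P (j - 1) * C i) (j : ZMod n) :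
    dihedralForm C x j = P j • dihedralForm C x 1 - P (j - 1) • dihedralForm C x 0 := by
  rw [dihedralForm, dihedralForm, dihedralForm, Finset.smul_sum, Finset.smul_sum,
    ← Finset.sum_sub_distrib]
  refine Finset.sum_congr rfl fun h _ => ?_
  rw [smul_smul, smul_smul, ← sub_smul]
  congr 1
  rcases h with i | i
  · rw [DihedralGroup.inv_r, dihedralPerm_r, dihedralPerm_r, dihedralPerm_r, add_comm _ j,
      add_comm _ 1, add_zero, hCP]
  · rw [DihedralGroup.inv_sr, dihedralPerm_sr, dihedralPerm_sr, dihedralPerm_sr, heven, heven,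
      heven, add_comm _ j, add_comm _ 1, add_zero, hCP]

/-- Over a field that contains `ℓ₁ / ℓ₀` the variables `x` are linearly dependent. -/
theorem not_linearIndependent_of_dihedralForm (heven : ∀ j, C (-j) = C j)
    (hC : C 0 ^ 2 ≠ C 1 ^ 2) (F : IntermediateField k Ω) (u : F)
    (hu : dihedralForm C x 1 = (u : Ω) * dihedralForm C x 0) : ¬ LinearIndependent F x := by
  intro hli
  have hcoeff := Fintype.linearIndependent_iff.mp hli
    (fun h => algebraMap k F (C (dihedralPerm n h⁻¹ 1)) -
      u * algebraMap k F (C (dihedralPerm n h⁻¹ 0))) (by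
    have h1 : ∀ j, dihedralForm C x j =
        ∑ h, algebraMap k F (C (dihedralPerm n h⁻¹ j)) • x h := fun j =>
      Finset.sum_congr rfl fun h _ => (algebraMap_smul F _ _).symm
    have h2 : (u : Ω) * dihedralForm C x 0 = u • dihedralForm C x 0 := rfl
    simp only [sub_smul, mul_smul]
    rw [Finset.sum_sub_distrib, ← Finset.smul_sum, ← h1, ← h1, hu, h2, sub_self])
  have h0 := hcoeff (DihedralGroup.r 0)
  have h1 := hcoeff (DihedralGroup.r 1)
  rw [DihedralGroup.inv_r, dihedralPerm_r, dihedralPerm_r] at h0 h1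
  simp only [neg_zero, zero_add, neg_add_cancel, add_zero, heven] at h0 h1
  apply hC
  apply (algebraMap k F).injective
  rw [map_pow, map_pow]
  linear_combination algebraMap k F (C 0) * h1 - algebraMap k F (C 1) * h0

theorem dihedralForm_zero_ne_zero (hC : C 0 ^ 2 ≠ C 1 ^ 2) (hx : AlgebraicIndependent k x)
    (heven : ∀ j, C (-j) = C j) : dihedralForm C x 0 ≠ 0 := by
  intro h
  have h1 := Fintype.linearIndependent_iff.mp hx.linearIndependent _ h
  have h0 := h1 (DihedralGroup.r 0)
  have h2 := h1 (DihedralGroup.r 1)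
  rw [DihedralGroup.inv_r, dihedralPerm_r] at h0 h2
  rw [add_zero, heven] at h0 h2
  exact hC (by rw [h0, h2])

/-- The quotient `ℓ₁ / ℓ₀`, a coordinate on the projective line of the two-dimensional
representation. -/
def dihedralCoordinate (C : ZMod n → k) (x : DihedralGroup n → Ω) : Ω :=
  dihedralForm C x 1 / dihedralForm C x 0

theorem transcendental_dihedralCoordinate (heven : ∀ j, C (-j) = C j) (hC : C 0 ^ 2 ≠ C 1 ^ 2)
    (hx : AlgebraicIndependent k x) : Transcendental k (dihedralCoordinate C x) := by
  -- The variables stay independent over the algebraic closure of `k` in `Ω`.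
  intro halg
  refine not_linearIndependent_of_dihedralForm heven hC (algebraicClosure k Ω)
    ⟨dihedralCoordinate C x, mem_algebraicClosure_iff.mpr halg⟩
    (div_mul_cancel₀ _ (dihedralForm_zero_ne_zero hC hx heven)).symm
    hx.algebraicClosure.linearIndependent

/-- The group acts on `ℓ₁ / ℓ₀` by Möbius transformations. -/
theorem map_dihedralCoordinate (hx : AlgebraicIndependent k x) (heven : ∀ j, C (-j) = C j)
    (hC : C 0 ^ 2 ≠ C 1 ^ 2)
    (hCP : ∀ i j, C (j + i) = P j * C (1 + i) - P (j - 1) * C i)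
    (a : DihedralGroup n →* Gal(Ω/k)) (hperm : ∀ g h, a g (x h) = x (g * h))
    (g : DihedralGroup n) :
    let u := dihedralCoordinate C x
    let p := dihedralPerm n g 1
    let q := dihedralPerm n g 0
    algebraMap k Ω (P q) * u - algebraMap k Ω (P (q - 1)) ≠ 0 ∧
      a g u = (algebraMap k Ω (P p) * u - algebraMap k Ω (P (p - 1))) /
        (algebraMap k Ω (P q) * u - algebraMap k Ω (P (q - 1))) := by
  intro u p q
  have h0 := dihedralForm_zero_ne_zero hC hx heven
  have hform : ∀ j, dihedralForm C x j / dihedralForm C x 0 =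
      algebraMap k Ω (P j) * u - algebraMap k Ω (P (j - 1)) := by
    intro j
    rw [dihedralForm_eq heven hCP j, Algebra.smul_def, Algebra.smul_def, sub_div, mul_div_assoc,
      mul_div_assoc, div_self h0, mul_one]
    rfl
  have hq : dihedralForm C x q ≠ 0 := by
    rw [← map_dihedralForm a hperm, map_ne_zero_iff _ (a g).injective]
    exact h0
  constructor
  · rw [← hform]
    exact div_ne_zero hq h0
  · rw [← hform, ← hform, div_div_div_cancel_right₀ h0, ← map_dihedralForm a hperm,
      ← map_dihedralForm a hperm, ← map_div₀]
    rfl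

/-- With `L = k(u)`, `u = ℓ₁ / ℓ₀`, the no-name lemma applies to the `L`-span of `1` and the `x_g`,
of dimension at most `2n`. The field `L^{Dₙ}` is rational by Lüroth's theorem. -/
theorem isRationalField_fixedField_regular {L : Type*} [Field L] [Algebra k L] {ζ : L}
    (hodd : Odd n) (hn : 3 ≤ n) (hζ : IsPrimitiveRoot ζ n)
    (hc : ζ + ζ⁻¹ ∈ (algebraMap k L).range) (hx : IsRationalBasis k x)
    (a : DihedralGroup n →* Gal(Ω/k)) (hperm : ∀ g h, a g (x h) = x (g * h)) :
    IsRationalField k (IntermediateField.fixedField a.range) := by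
  obtain ⟨C, P, heven, hC, hCP, hP⟩ := exists_cyclotomic_sequences hodd hn hζ hc
  set u := dihedralCoordinate C x with hu
  set w : Unit → Ω := fun _ => u with hw
  have hutr : Transcendental k u := transcendental_dihedralCoordinate heven hC hx.indep
  have hwind : AlgebraicIndependent k w := algebraicIndependent_unique_type_iff.mpr hutr
  have huF : u ∈ IntermediateField.adjoin k (Set.range w) :=
    IntermediateField.subset_adjoin _ _ ⟨(), rfl⟩
  have hau := map_dihedralCoordinate hx.indep heven hC hCP a hperm
  have hF : ∀ g, ∀ y ∈ IntermediateField.adjoin k (Set.range w),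
      a g y ∈ IntermediateField.adjoin k (Set.range w) := by
    refine mem_adjoin_of_semilinear (1 : DihedralGroup n →* Gal(k/k)) a
      (fun g c => (a g).commutes c) ?_
    rintro g _ ⟨_, rfl⟩
    have hmem : ∀ b c : k, algebraMap k Ω b * u - algebraMap k Ω c ∈
        IntermediateField.adjoin k (Set.range w) := fun b c =>
      sub_mem (mul_mem (IntermediateField.algebraMap_mem _ _) huF)
        (IntermediateField.algebraMap_mem _ _)
    change a g u ∈ _
    rw [(hau g).2]
    exact div_mem (hmem _ _) (hmem _ _)
  have hfaith : Injective (restrictAction a _ hF) := by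
    rw [injective_iff_map_eq_one]
    intro g hg
    have hgu : a g u = u :=
      (coe_restrictAction a _ hF g ⟨u, huF⟩).symm.trans (by rw [hg]; rfl)
    obtain ⟨hne, heq⟩ := hau g
    rw [← hu] at hne heq
    rw [hgu, eq_div_iff hne] at heq
    set p := dihedralPerm n g 1
    set q := dihedralPerm n g 0
    -- The fixed points of the Möbius transformation `g` are the roots of this polynomial.
    have hpoly : Polynomial.C (P q) * Polynomial.X ^ 2 -
        Polynomial.C (P (q - 1) + P p) * Polynomial.X + Polynomial.C (P (p - 1)) = 0 := by
      refine (transcendental_iff.mp hutr) _ ?_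
      simp only [map_add, map_sub, map_mul, map_pow, Polynomial.aeval_C, Polynomial.aeval_X]
      linear_combination heq
    have hcoeff := fun i => congrArg (fun f => Polynomial.coeff f i) hpoly
    have h0 := hcoeff 0
    have h2 := hcoeff 2
    simp [Polynomial.coeff_X, Polynomial.coeff_C] at h0 h2
    refine eq_one_of_dihedralPerm_eq n hn (hP _ h2) (sub_eq_zero.mp (hP _ h0))
  set F := IntermediateField.adjoin k (Set.range w) with hFdef
  set y : Option (DihedralGroup n) → Ω := fun o => o.elim 1 x with hy
  obtain ⟨e⟩ := fixedField_equiv_of_adjoin a hwind hF hfaith y (by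
      rintro g (_ | h)
      · exact Submodule.subset_span ⟨none, (map_one (a g)).symm⟩
      · exact Submodule.subset_span ⟨some (g * h), (hperm g h).symm⟩)
    (Submodule.subset_span ⟨none, rfl⟩) (by
      rw [← top_le_iff, ← hx.adjoin_eq_top]
      refine IntermediateField.adjoin.mono _ _ _ ?_
      rintro _ ⟨h, rfl⟩
      exact Or.inr ⟨some h, rfl⟩) (2 * n - 1) (by
      -- The `2n + 1` elements `1` and `x_g` are dependent over `k(u)`, as `ℓ₁ = u ℓ₀`.
      by_contra hlt
      have hli : LinearIndependent F y := by
        rw [linearIndependent_iff_card_le_finrank_span, Fintype.card_option, DihedralGroup.card]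
        exact le_of_eq_of_le (by omega) (not_le.mp hlt)
      exact not_linearIndependent_of_dihedralForm heven hC F ⟨u, huF⟩
        (div_mul_cancel₀ _ (dihedralForm_zero_ne_zero hC hx.indep heven)).symm
        (hli.comp some (Option.some_injective _))) (by
      rw [hx.trdeg, DihedralGroup.nat_card, Nat.card_unique]
      exact Nat.cast_le.mpr (by omega))
  obtain ⟨f⟩ := (isRationalBasis_ratFunc_X k).nonempty_equiv
  refine IsRationalField.congr ?_ e
  exact (isRationalField_of_ratFunc_equiv (f.trans hwind.aevalEquivField) _).mvPolynomial _

end TwoDimensional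

end

theorem theorem1p4 (n : ℕ) (hodd : Odd n) (hn : 3 ≤ n) (k : Type*) [Field k] :
    -- `k'(R^ab)^{Dₙ} ≅ k'(ℤ[Dₙ])^{Dₙ}(t)` for a finite Galois extension `k'/k` on which `Dₙ` acts
    -- through a surjection `ρ : Dₙ → Gal(k'/k)`
    (∀ (k' : Type*) [Field k'] [Algebra k k'] [FiniteDimensional k k'] [IsGalois k k']
      (ρ : DihedralGroup n →* Gal(k'/k)), Function.Surjective ρ →
      Nonempty (latticeFixedField ρ (dihedralRelationRep n) ≃ₐ[k]
        RatFunc (latticeFixedField ρ (Representation.leftRegular ℤ (DihedralGroup n))))) ∧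
    -- `k(R^ab)^{Dₙ} ≅ k(Dₙ)(t)`, where `Dₙ` acts trivially on `k`
    Nonempty (latticeFixedField (1 : DihedralGroup n →* Gal(k/k)) (dihedralRelationRep n) ≃ₐ[k]
      RatFunc (noetherField k (DihedralGroup n))) ∧
    -- a positive answer to Noether's problem makes `k(R^ab)^{Dₙ}` rational over `k`
    (IsRationalField k (noetherField k (DihedralGroup n)) →
      IsRationalField k
        (latticeFixedField (1 : DihedralGroup n →* Gal(k/k)) (dihedralRelationRep n))) ∧
    -- if `ζₙ + ζₙ⁻¹ ∈ k`, then both fields are rational over `k`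
    (∀ (L : Type*) [Field L] [Algebra k L] (ζ : L), IsPrimitiveRoot ζ n →
      ζ + ζ⁻¹ ∈ (algebraMap k L).range →
      IsRationalField k (noetherField k (DihedralGroup n)) ∧
      IsRationalField k
        (latticeFixedField (1 : DihedralGroup n →* Gal(k/k)) (dihedralRelationRep n))) ∧
    -- if `Dₙ ≅ Gal(K/k)`, then `K(R^ab)^{Dₙ}` is rational over `k`
    (∀ (K : Type*) [Field K] [Algebra k K] [FiniteDimensional k K] [IsGalois k K]
      (ρ : DihedralGroup n ≃* Gal(K/k)),
      IsRationalField k (latticeFixedField ρ.toMonoidHom (dihedralRelationRep n))) := by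
  have : NeZero n := ⟨by omega⟩
  have hnoether := isRationalBasis_X k (DihedralGroup n)
  have hequiv : Nonempty (latticeFixedField (1 : DihedralGroup n →* Gal(k/k))
      (dihedralRelationRep n) ≃ₐ[k] RatFunc (noetherField k (DihedralGroup n))) :=
    latticeFixedField_relation_equiv_ratFunc hodd hn 1 (noetherAction k (DihedralGroup n))
      (fun g c => (noetherAction k (DihedralGroup n) g).commutes c) hnoether
      (noetherAction_X k (DihedralGroup n))
  have hrat : IsRationalField k (noetherField k (DihedralGroup n)) → IsRationalField k
      (latticeFixedField (1 : DihedralGroup n →* Gal(k/k)) (dihedralRelationRep n)) := by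
    intro h
    obtain ⟨e⟩ := hequiv
    exact h.ratFunc.congr e
  refine ⟨fun k' _ _ _ _ ρ _ => ?_, hequiv, hrat, fun L _ _ ζ hζ hc => ?_,
    fun K _ _ _ _ ρ => isRationalField_relation_of_equiv n hodd K ρ⟩
  · have hbasis : ⇑(MonoidAlgebra.basis (DihedralGroup n) ℤ) =
        fun g : DihedralGroup n => MonoidAlgebra.single g (1 : ℤ) := by
      funext g
      rfl
    have hli := (MonoidAlgebra.basis (DihedralGroup n) ℤ).linearIndependent
    have hspan := (MonoidAlgebra.basis (DihedralGroup n) ℤ).span_eq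
    rw [hbasis] at hli hspan
    refine latticeFixedField_relation_equiv_ratFunc hodd hn ρ _
      (latticeFieldAction_algebraMap ρ _) (isRationalBasis_latticeMonomial hli hspan)
      fun g h => ?_
    rw [latticeFieldAction_monomial, Representation.ofMulAction_single, smul_eq_mul]
  · have h : IsRationalField k (noetherField k (DihedralGroup n)) :=
      isRationalField_fixedField_regular hodd hn hζ hc hnoether _
        (noetherAction_X k (DihedralGroup n))
    exact ⟨h, hrat h⟩
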